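/- Setting. Let $1\le q\le p$ be integers, $\beta\in(0,1]$, $\mathcal F\subseteq\mathbb R^n$ closed, $x_0\in\mathcal F$. Let $f:\mathbb R^n\to\mathbb R$ be $p$ times continuously differentiable, bounded below by $f_{\rm low}$, with $\|\nabla^p f(x)-\nabla^p f(y)\|\le L\|x-y\|^\beta$ for all $x,y$, where $\|S\|=\max_{\|v_1\|=\dots=\|v_j\|=1}|S[v_1,\dots,v_j]|$ for tensors. Write $\chi_r(\delta)=\sum_{\ell=1}^r\delta^\ell/\ell!$, $(i+\beta)!=\prod_{\ell=1}^i(\ell+\beta)$, $\Delta T_r(x,d)=-\sum_{\ell=1}^r\frac1{\ell!}\nabla^\ell f(x)[d]^\ell$ and $\phi_{f,r}^{\delta}(x)=\max\{\Delta T_r(x,d): x+d\in\mathcal F,\ \|d\|\le\delta\}$. The same notions with approximate derivatives carry a bar. A point $x$ is an $(\epsilon,\delta)$-approximate $q$-th-order-necessary minimizer if $\phi_{f,q}^\delta(x)\le\epsilon\chi_q(\delta)$. The AR$p$DA algorithm. Fixed constants: $\theta>0$, $\mu,\delta_{-1}\in(0,1]$, $0<\sigma_{\min}\le\sigma_0$,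 $0<\eta_1\le\eta_2<1$, $0<\gamma_1<1<\gamma_2<\gamma_3$, $\alpha\in(0,1)$, $\kappa_\omega\in(0,\frac12\alpha\eta_1]$, $\gamma_\varepsilon,\vartheta\in(0,1)$, $\kappa_\varepsilon>0$. Let $\epsilon\in(0,1)$. The procedure $\mathrm{VERIFY}_r(\delta,T,\{\zeta_j\}_{j\le r},\omega,\xi)$ returns the first applicable of: 1 if $T=0$ and $\max_j\zeta_j\le\xi$; 2 if $T>0$ and $\sum_j\zeta_j\delta^j/j!\le\omega T$; 3 if $T>0$ and $\sum_j\zeta_j\delta^j/j!\le\xi\chi_r(\delta)$; otherwise 0. Iteration $k=0,1,\dots$, with $\omega_k=\min[\kappa_\omega,1/\sigma_k]$ and $\xi_k=\frac12\omega_k\epsilon$, is as follows. Step 1. Choose accuracies $\varepsilon_1,\dots,\varepsilon_p\in(0,\kappa_\varepsilon]$ with $\varepsilon_\ell\le\varepsilon_j$ whenever $j\le q$ and $j\le\ell\le p$. Repeat the following pass. Compute approximations $\overline{\nabla^jf}(x_k)$ with requested accuracy $\varepsilon_j$, $j\le q$ (a value already available at $x_k$ that was requested with an accuracy at least as fine may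 be reused), and the maximal increment $v=\max\{\overline{\Delta T}_q(x_k,d):x_k+d\in\mathcal F,\|d\|\le\delta_{k-1}\}$; let flag $=\mathrm{VERIFY}_q(\delta_{k-1},v,\{\varepsilon_j\},\omega_k,\xi_k)$. If flag is 1 or 3, or if flag is 2 and $\overline\phi_{f,q}^{\delta_{k-1}}(x_k)\le\frac{\epsilon}{1+\omega_k}\chi_q(\delta_{k-1})$, terminate with $x_\epsilon=x_k$. If flag is 2 otherwise, go to Step 2. If flag is 0, multiply all $\varepsilon_j$ by $\gamma_\varepsilon$ and repeat. Step 2. Repeat the following pass, with the current $\varepsilon_j$. Compute (or reuse, as above) $\overline{\nabla^jf}(x_k)$ for $j\le p$, and let $m_k(s)=-\overline{\Delta T}_p(x_k,s)+\frac{\sigma_k}{(p+\beta)!}\|s\|^{p+\beta}$ (up to a constant). If possible, compute $s_k\ne0$ with $x_k+s_k\in\mathcal F$, $m_k(s_k)<m_k(0)$ and $\delta_k\in(0,1]$ such that $$(\ast)\qquad \|s_k\|\ge\mu\epsilon^{1/(p-q+\beta)}\quad\text{or}\quad\overline\phi_{m_k,q}^{\delta_k}(s_k)\le\frac{\theta\|s_k\|^{p-q+\beta}}{(p-q+\beta)!}\chi_q(\delta_k);$$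 let $v$ be the maximal order-$q$ Taylor increment of $m_k$ at $s_k$ over feasible displacements of length at most $\delta_k$, and $\mathrm{flag}_s=\mathrm{VERIFY}_p(\|s_k\|,\overline{\Delta T}_p(x_k,s_k),\{\varepsilon_j\},\omega_k,\xi_k)$. If no feasible nonzero descent step exists, or if $\mathrm{flag}_s\in\{1,3\}$, replace $s_k$ by a global minimizer of $m_k(s)$ over $x_k+s\in\mathcal F$, set $v=0$ and recompute $\mathrm{flag}_s$; if it is then 1 or 3, terminate with $x_\epsilon=x_k$; if it is 2, $\delta_k\in(0,1]$ is chosen so that $(\ast)$ holds. If $\mathrm{flag}_s=2$ and either $\|s_k\|\ge\mu\epsilon^{1/(p-q+\beta)}$ or $\mathrm{VERIFY}_q\big(\delta_k,v,\{3\varepsilon_j\},\omega_k,\frac{\vartheta(1-\kappa_\omega)}{(1+\kappa_\omega)^2}\xi_k\big)>0$, go to Step 3. Otherwise multiply all $\varepsilon_j$ by $\gamma_\varepsilon$ and repeat. Step 3. With $e_k=\omega_k|\overline{\Delta T}_p(x_k,s_k)|$, compute an approximation $\overline f_k^+$ of $f(x_k+s_k)$, and compute an approximation $\overline f_k$ of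 $f(x_k)$ or, if $k>0$ and $e_{k-1}\le e_k$, reuse the one from iteration $k-1$; the requested absolute accuracy is $e_k$. Let $\rho_k=(\overline f_k-\overline f_k^+)/\overline{\Delta T}_p(x_k,s_k)$. Set $x_{k+1}=x_k+s_k$ if $\rho_k\ge\eta_1$ and $x_{k+1}=x_k$ otherwise. Choose $\sigma_{k+1}$ in $[\max(\sigma_{\min},\gamma_1\sigma_k),\sigma_k]$ if $\rho_k\ge\eta_2$, in $[\sigma_k,\gamma_2\sigma_k]$ if $\eta_1\le\rho_k<\eta_2$, in $[\gamma_2\sigma_k,\gamma_3\sigma_k]$ if $\rho_k<\eta_1$. Probabilistic assumptions. The approximations, and hence the run, are random. In each iteration $k$ there are $p+q+2$ accuracy requirements, one for each of: $\overline{\nabla^jf}(x_k)$ in the last pass of Step 1 ($1\le j\le q$); $\overline{\nabla^jf}(x_k)$ in the last pass of Step 2 ($1\le j\le p$); $\overline f_k^+$; $\overline f_k$. There are mutually independent events $E_{k,i}$ ($k\ge0$, $1\le i\le p+q+2$), each of probability at least $1-t$, $t\in[0,1)$, such that on $E_{k,i}$ the $i$-th quantity, if it is newly evaluated there, has an error within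 its requested accuracy: $\|\overline{\nabla^jf}(x_k)-\nabla^jf(x_k)\|\le\varepsilon_j$, $|\overline f_k^+-f(x_k+s_k)|\le e_k$, $|\overline f_k-f(x_k)|\le e_k$, respectively. (For instance, the accuracy bounds themselves are such events.) Theorem. There are constants $C,c>0$, depending only on $p,q,\beta,L$, on the constants of the algorithm (including $\sigma_0$, but not $\epsilon$) and on an upper bound for $f(x_0)-f_{\rm low}$, such that for all $\epsilon,\bar t\in(0,1)$: if $$t\le c\,\frac{\bar t\,\epsilon^{\frac{p+\beta}{p-q+\beta}}}{p+q+2},$$ then with probability at least $1-\bar t$ the AR$p$DA algorithm terminates after at most $C\epsilon^{-\frac{p+\beta}{p-q+\beta}}$ iterations, at most $C\epsilon^{-\frac{p+\beta}{p-q+\beta}}$ approximate evaluations of $f$ and at most $C(1+|\log\epsilon|)\epsilon^{-\frac{p+\beta}{p-q+\beta}}$ approximate evaluations of derivatives of orders $1,\dots,p$ (each tensor counted separately), with a point $x_\epsilon\in\mathcal F$ such that either $x_\epsilon$ is an $(\epsilon,\delta)$-approximate $q$-th-order-necessary minimizer for some $\delta\in(0,1]$, or the algorithm terminated in Step 2 with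 a global model minimizer $s\neq0$ for which $\phi_{f,p}^{\|s\|}(x_\epsilon)\le\epsilon\chi_p(\|s\|)$. -/

import Mathlib

open Set MeasureTheory ProbabilityTheory

namespace ARpDA

/-- The space `ℝⁿ` with its Euclidean norm. -/
abbrev Vec (n : ℕ) := EuclideanSpace ℝ (Fin n)

/-- Tensors of order `j`, normed by `max |S[v₁, …, vⱼ]|` over unit vectors. -/
abbrev Tensor (n j : ℕ) := ContinuousMultilinearMap ℝ (fun _ : Fin j => Vec n) ℝ

/-- `(i + β)! = ∏_{ℓ=1}^{i} (ℓ + β)`. -/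
noncomputable def fracFactorial (i : ℕ) (β : ℝ) : ℝ :=
  ∏ ℓ ∈ Finset.Icc 1 i, ((ℓ : ℝ) + β)

/-- `χ_r(δ) = ∑_{ℓ=1}^{r} δ^ℓ / ℓ!`. -/
noncomputable def chi (r : ℕ) (δ : ℝ) : ℝ :=
  ∑ ℓ ∈ Finset.Icc 1 r, δ ^ ℓ / (ℓ.factorial : ℝ)

/-- The Taylor increment `ΔT_r(s) = T_r(0) - T_r(s)` of the Taylor polynomial
`T_r(s) = const + ∑_{ℓ=1}^{r} D_ℓ[s]^ℓ / ℓ!` with derivative tensors `D_ℓ`. -/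
noncomputable def taylorDecrease {n : ℕ} (D : ∀ j, Tensor n j) (r : ℕ) (s : Vec n) : ℝ :=
  -∑ ℓ ∈ Finset.Icc 1 r, D ℓ (fun _ => s) / (ℓ.factorial : ℝ)

/-- The displacements `d` with `y + d ∈ F` and `‖d‖ ≤ δ`. -/
def feasible {n : ℕ} (F : Set (Vec n)) (y : Vec n) (δ : ℝ) : Set (Vec n) :=
  {d | y + d ∈ F ∧ ‖d‖ ≤ δ}

/-- The optimality measure at `y` built from the derivative tensors `D`: the largest Taylor
increment of order `r` over the feasible displacements of length at most `δ`. -/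
noncomputable def phi {n : ℕ} (F : Set (Vec n)) (D : ∀ j, Tensor n j) (r : ℕ) (y : Vec n)
    (δ : ℝ) : ℝ :=
  sSup (taylorDecrease D r '' feasible F y δ)

/-- The inexact optimality measure `max[0, max_d ΔT_r(d)]`. -/
noncomputable def phiBar {n : ℕ} (F : Set (Vec n)) (D : ∀ j, Tensor n j) (r : ℕ) (y : Vec n)
    (δ : ℝ) : ℝ :=
  max 0 (phi F D r y δ)

/-- The exact derivative tensors of `f` at `x`. -/
noncomputable def derivs {n : ℕ} (f : Vec n → ℝ) (x : Vec n) (j : ℕ) : Tensor n j :=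
  iteratedFDeriv ℝ j f x

/-- `f` is `p` times continuously differentiable and its `p`-th derivative tensor is globally
Hölder continuous with exponent `β` and constant `L`. -/
def HolderSmooth {n : ℕ} (p : ℕ) (β L : ℝ) (f : Vec n → ℝ) : Prop :=
  ContDiff ℝ (p : WithTop ℕ∞) f ∧
    ∀ x y, ‖iteratedFDeriv ℝ p f x - iteratedFDeriv ℝ p f y‖ ≤ L * ‖x - y‖ ^ β

/-- The VERIFY algorithm; the value is its flag. -/
noncomputable def verify (r : ℕ) (δ dT : ℝ) (ζ : ℕ → ℝ) (ω ξ : ℝ) : ℕ :=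
  open Classical in
  if dT = 0 ∧ ∀ j ∈ Finset.Icc 1 r, ζ j ≤ ξ then 1
  else if 0 < dT ∧ ∑ j ∈ Finset.Icc 1 r, ζ j / (j.factorial : ℝ) * δ ^ j ≤ ω * dT then 2
  else if 0 < dT ∧ ∑ j ∈ Finset.Icc 1 r, ζ j / (j.factorial : ℝ) * δ ^ j ≤ ξ * chi r δ then 3
  else 0

/-- Model degree `p`, optimality order `q`, Hölder exponent `β` and the constants of the
algorithm (all of them except the accuracy level `ε`), with their admissible ranges. -/
structure Params where
  p : ℕ
  q : ℕ
  β : ℝ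
  δinit : ℝ
  θ : ℝ
  μ : ℝ
  η₁ : ℝ
  η₂ : ℝ
  γ₁ : ℝ
  γ₂ : ℝ
  γ₃ : ℝ
  σmin : ℝ
  σ₀ : ℝ
  α : ℝ
  κω : ℝ
  γε : ℝ
  κε : ℝ
  ϑ : ℝ
  one_le_q : 1 ≤ q
  q_le_p : q ≤ p
  β_mem : β ∈ Ioc (0 : ℝ) 1
  δinit_mem : δinit ∈ Ioc (0 : ℝ) 1
  θ_pos : 0 < θ
  μ_mem : μ ∈ Ioc (0 : ℝ) 1
  η₁_pos : 0 < η₁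
  η₁_le : η₁ ≤ η₂
  η₂_lt : η₂ < 1
  γ₁_mem : γ₁ ∈ Ioo (0 : ℝ) 1
  one_lt_γ₂ : 1 < γ₂
  γ₂_lt : γ₂ < γ₃
  σmin_mem : σmin ∈ Ioc (0 : ℝ) σ₀
  α_mem : α ∈ Ioo (0 : ℝ) 1
  κω_mem : κω ∈ Ioc (0 : ℝ) (α * η₁ / 2)
  γε_mem : γε ∈ Ioo (0 : ℝ) 1
  κε_pos : 0 < κε
  ϑ_mem : ϑ ∈ Ioo (0 : ℝ) 1

namespace Params

/-- `p - q + β`. -/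
def gapExp (P : Params) : ℝ := (P.p : ℝ) - P.q + P.β

/-- The complexity exponent `(p + β) / (p - q + β)`. -/
noncomputable def rate (P : Params) : ℝ := ((P.p : ℝ) + P.β) / P.gapExp

/-- The relative accuracy `ω = min[κ_ω, 1/σ]` attached to the regularization parameter `σ`. -/
noncomputable def relAcc (P : Params) (σ : ℝ) : ℝ := min P.κω (1 / σ)

/-- The regularized model
`m(s) = const + ∑_{ℓ=1}^{p} D_ℓ[s]^ℓ / ℓ! + σ / (p+β)! ‖s‖^{p+β}`, normalized by `m(0) = 0`
(only differences of model values and derivatives of the model are ever used). -/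
noncomputable def model (P : Params) {n : ℕ} (D : ∀ j, Tensor n j) (σ : ℝ) (s : Vec n) : ℝ :=
  -taylorDecrease D P.p s + σ / fracFactorial P.p P.β * ‖s‖ ^ ((P.p : ℝ) + P.β)

/-- The absolute accuracy `ξ = ω ε / 2` of the accuracy checks for `f`. -/
noncomputable def xi (P : Params) (ε σ : ℝ) : ℝ := P.relAcc σ * ε / 2

/-- The absolute accuracy of the accuracy check for the model. -/
noncomputable def xiModel (P : Params) (ε σ : ℝ) : ℝ :=
  P.ϑ * (1 - P.κω) / (1 + P.κω) ^ 2 * (P.relAcc σ * ε / 2)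

end Params

/-- What the algorithm does next. -/
inductive Stage (n : ℕ) where
  /-- Begin an iteration: choose the initial derivative accuracies. -/
  | start
  /-- Step 1 (optimality test): evaluate the derivatives of orders `1, …, q`. -/
  | eval1
  /-- Step 1: compute the optimality measure, verify its accuracy. -/
  | check1
  /-- Step 2 (step computation): evaluate the derivatives of orders `1, …, p`. -/
  | eval2
  /-- Step 2: compute the step, verify its accuracy. -/
  | check2
  /-- Function evaluations for the step `s` and the next radius `δ'`. -/
  | evalF (s : Vec n) (δ' : ℝ)
  /-- Acceptance test and parameter updates, with the approximate values `f0` of `f(x)` and `fp` of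
  `f(x + s)`; `fresh0` tells whether `f0` was newly computed in this iteration. -/
  | update (s : Vec n) (δ' f0 fp : ℝ) (fresh0 : Bool)
  /-- Terminated in Step 1. -/
  | stop1
  /-- Terminated in Step 2, with the global model minimizer `s`. -/
  | stop2 (s : Vec n)

/-- A configuration of the algorithm. -/
structure Config (n : ℕ) where
  /-- iteration index `k` -/
  iter : ℕ
  /-- current iterate `x_k` -/
  x : Vec n
  /-- regularization parameter `σ_k` -/
  σ : ℝ
  /-- optimality radius `δ_{k-1}` -/
  δ : ℝ
  /-- current absolute accuracies `ε_j` requested for the derivatives of order `j` -/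
  acc : ℕ → ℝ
  /-- most recent approximations of the derivative tensors at `x_k` -/
  D : ∀ j, Tensor n j
  /-- accuracy that was requested for `D j`; `⊤` if there is no approximation at `x_k` -/
  got : ℕ → WithTop ℝ
  /-- orders that were newly evaluated in the latest derivative evaluation -/
  fresh : Finset ℕ
  /-- most recent approximation of `f(x_k)` -/
  fval : ℝ
  /-- accuracy that was requested for `fval`; `⊤` if there is none -/
  fgot : WithTop ℝ
  /-- number of approximate evaluations of `f` so far -/
  numF : ℕ
  /-- number of approximate evaluations of derivative tensors (of any order) so far -/
  numD : ℕ
  stage : Stage n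

/-- The initial configuration. -/
noncomputable def Config.initial (P : Params) {n : ℕ} (x₀ : Vec n) : Config n where
  iter := 0
  x := x₀
  σ := P.σ₀
  δ := P.δinit
  acc := fun _ => 0
  D := fun _ => 0
  got := fun _ => ⊤
  fresh := ∅
  fval := 0
  fgot := ⊤
  numF := 0
  numD := 0
  stage := Stage.start

section Steps

variable (P : Params) {n : ℕ} (F : Set (Vec n)) (ε : ℝ)

/-- Admissible initial accuracies: positive, at most `κ_ε`, and such that the accuracy
of a derivative of order `j ≤ q` is not finer than those of the derivatives of higher order. -/
def AdmissibleAcc (e : ℕ → ℝ) : Prop :=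
  (∀ j ∈ Finset.Icc 1 P.p, 0 < e j ∧ e j ≤ P.κε) ∧
    ∀ j ∈ Finset.Icc 1 P.q, ∀ l ∈ Finset.Icc j P.p, e l ≤ e j

/-- `c'` arises from `c` by making approximations of the derivatives of orders `1, …, r` at the
current iterate available with the current accuracies, and passing to stage `next`. An order may
be left unevaluated only if an approximation at the same point, requested with an accuracy at
least as fine, is available. -/
def Evaluates (r : ℕ) (next : Stage n) (c c' : Config n) : Prop :=
  ∃ (S : Finset ℕ) (D' : ∀ j, Tensor n j) (got' : ℕ → WithTop ℝ),
    S ⊆ Finset.Icc 1 r ∧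
    (∀ j ∈ Finset.Icc 1 r, j ∉ S → c.got j ≤ (c.acc j : WithTop ℝ)) ∧
    (∀ j ∈ S, got' j = (c.acc j : WithTop ℝ)) ∧
    (∀ j, j ∉ S → D' j = c.D j ∧ got' j = c.got j) ∧
    c' = { c with D := D', got := got', fresh := S, numD := c.numD + S.card, stage := next }

/-- `v` is the global maximum of the inexact order-`q` Taylor increment at the iterate and `flag` is
the flag returned by VERIFY. -/
def Check1 (c : Config n) (flag : ℕ) : Prop :=
  ∃ v, IsGreatest (taylorDecrease c.D P.q '' feasible F c.x c.δ) v ∧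
    flag = verify P.q c.δ v c.acc (P.relAcc c.σ) (P.xi ε c.σ)

/-- The termination test `φ̄_{f,q}^δ(x, ω) ≤ ε / (1 + ω) χ_q(δ)`. -/
def Test1 (c : Config n) : Prop :=
  phiBar F c.D P.q c.x c.δ ≤ ε / (1 + P.relAcc c.σ) * chi P.q c.δ

/-- The (approximate) derivatives of the current model at `s`. -/
noncomputable def modelDerivs (c : Config n) (s : Vec n) (j : ℕ) : Tensor n j :=
  iteratedFDeriv ℝ j (P.model c.D c.σ) s

/-- `‖s‖ ≥ μ ε^{1/(p-q+β)}`. -/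
def LongStep (s : Vec n) : Prop := P.μ * ε ^ (1 / P.gapExp) ≤ ‖s‖

/-- The step is long or the model's optimality measure at `s` is small. -/
def StepTest (c : Config n) (s : Vec n) (δ' : ℝ) : Prop :=
  LongStep P ε s ∨
    phiBar F (modelDerivs P c s) P.q (c.x + s) δ' ≤
      P.θ * ‖s‖ ^ P.gapExp / fracFactorial (P.p - P.q) P.β * chi P.q δ'

/-- Some feasible nonzero step decreases the model. -/
def CanDescend (c : Config n) : Prop :=
  ∃ s, s ≠ 0 ∧ c.x + s ∈ F ∧ P.model c.D c.σ s < P.model c.D c.σ 0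

/-- `s`, with the radius `δ'`, is an approximate model minimizer. -/
def TrialStep (c : Config n) (s : Vec n) (δ' : ℝ) : Prop :=
  s ≠ 0 ∧ c.x + s ∈ F ∧ P.model c.D c.σ s < P.model c.D c.σ 0 ∧
    δ' ∈ Ioc (0 : ℝ) 1 ∧ StepTest P F ε c s δ'

/-- The flag returned by VERIFY for the increment `ΔT_p(x, s)`. -/
noncomputable def flagS (c : Config n) (s : Vec n) : ℕ :=
  verify P.p ‖s‖ (taylorDecrease c.D P.p s) c.acc (P.relAcc c.σ) (P.xi ε c.σ)

/-- `s` is a global model minimizer, computed because no descent step exists or because VERIFY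
returned 1 or 3 for an approximate minimizer. -/
def GlobalStep (c : Config n) (s : Vec n) : Prop :=
  (¬ CanDescend P F c ∨
    ∃ s₁ δ₁, TrialStep P F ε c s₁ δ₁ ∧ (flagS P ε c s₁ = 1 ∨ flagS P ε c s₁ = 3)) ∧
  c.x + s ∈ F ∧ ∀ s', c.x + s' ∈ F → P.model c.D c.σ s ≤ P.model c.D c.σ s'

/-- The flag returned by VERIFY for the model increment `v` of order `q`. -/
noncomputable def flagD (c : Config n) (δ' v : ℝ) : ℕ :=
  verify P.q δ' v (fun j => 3 * c.acc j) (P.relAcc c.σ) (P.xiModel ε c.σ)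

/-- The increment of the step `s` has flag 2, and `δ'` and `v` are the radius and the model
increment that come with it (the maximal increment for an approximate minimizer; it is set to zero
for a global minimizer). -/
def Candidate (c : Config n) (s : Vec n) (δ' v : ℝ) : Prop :=
  flagS P ε c s = 2 ∧
    ((TrialStep P F ε c s δ' ∧
        IsGreatest (taylorDecrease (modelDerivs P c s) P.q '' feasible F (c.x + s) δ') v) ∨
      (GlobalStep P F ε c s ∧ δ' ∈ Ioc (0 : ℝ) 1 ∧ StepTest P F ε c s δ' ∧ v = 0))

/-- The required accuracy `ω |ΔT_p(x, s)|` of function values. -/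
noncomputable def fAcc (c : Config n) (s : Vec n) : ℝ :=
  P.relAcc c.σ * |taylorDecrease c.D P.p s|

/-- The admissible values of the next regularization parameter. -/
def SigmaUpdate (ρ σ σ' : ℝ) : Prop :=
  (P.η₂ ≤ ρ → σ' ∈ Icc (max P.σmin (P.γ₁ * σ)) σ) ∧
    (P.η₁ ≤ ρ → ρ < P.η₂ → σ' ∈ Icc σ (P.γ₂ * σ)) ∧
    (ρ < P.η₁ → σ' ∈ Icc (P.γ₂ * σ) (P.γ₃ * σ))

/-- One transition of the algorithm. -/
inductive Step : Config n → Config n → Prop where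
  | choose (c : Config n) (e : ℕ → ℝ) (hc : c.stage = Stage.start) (he : AdmissibleAcc P e) :
      Step c { c with acc := e, stage := Stage.eval1 }
  | eval1 (c c' : Config n) (hc : c.stage = Stage.eval1)
      (h : Evaluates P.q Stage.check1 c c') : Step c c'
  | stop1 (c : Config n) (flag : ℕ) (hc : c.stage = Stage.check1) (h : Check1 P F ε c flag)
      (hf : flag = 1 ∨ flag = 3 ∨ (flag = 2 ∧ Test1 P F ε c)) :
      Step c { c with stage := Stage.stop1 }
  | pass1 (c : Config n) (flag : ℕ) (hc : c.stage = Stage.check1) (h : Check1 P F ε c flag)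
      (hf : flag = 2 ∧ ¬ Test1 P F ε c) :
      Step c { c with stage := Stage.eval2 }
  | retry1 (c : Config n) (flag : ℕ) (hc : c.stage = Stage.check1) (h : Check1 P F ε c flag)
      (hf : flag = 0) :
      Step c { c with acc := fun j => P.γε * c.acc j, stage := Stage.eval1 }
  | eval2 (c c' : Config n) (hc : c.stage = Stage.eval2)
      (h : Evaluates P.p Stage.check2 c c') : Step c c'
  | retryTrial (c : Config n) (s : Vec n) (δ' : ℝ) (hc : c.stage = Stage.check2)
      (hs : TrialStep P F ε c s δ') (hf : flagS P ε c s = 0) :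
      Step c { c with acc := fun j => P.γε * c.acc j, stage := Stage.eval2 }
  | retryGlobal (c : Config n) (s : Vec n) (hc : c.stage = Stage.check2)
      (hs : GlobalStep P F ε c s) (hf : flagS P ε c s = 0) :
      Step c { c with acc := fun j => P.γε * c.acc j, stage := Stage.eval2 }
  | retryModel (c : Config n) (s : Vec n) (δ' v : ℝ) (hc : c.stage = Stage.check2)
      (hs : Candidate P F ε c s δ' v) (hl : ¬ LongStep P ε s) (hf : flagD P ε c δ' v = 0) :
      Step c { c with acc := fun j => P.γε * c.acc j, stage := Stage.eval2 }
  | stop2 (c : Config n) (s : Vec n) (hc : c.stage = Stage.check2)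
      (hs : GlobalStep P F ε c s) (hf : flagS P ε c s = 1 ∨ flagS P ε c s = 3) :
      Step c { c with stage := Stage.stop2 s }
  | pass2 (c : Config n) (s : Vec n) (δ' v : ℝ) (hc : c.stage = Stage.check2)
      (hs : Candidate P F ε c s δ' v) (hf : LongStep P ε s ∨ 0 < flagD P ε c δ' v) :
      Step c { c with stage := Stage.evalF s δ' }
  | computeF (c : Config n) (s : Vec n) (δ' f0 fp : ℝ) (hc : c.stage = Stage.evalF s δ') :
      Step c { c with
        numF := c.numF + 2
        stage := Stage.update s δ' f0 fp true }
  | reuseF (c : Config n) (s : Vec n) (δ' fp : ℝ) (hc : c.stage = Stage.evalF s δ')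
      (h : c.fgot ≤ (fAcc P c s : WithTop ℝ)) :
      Step c { c with
        numF := c.numF + 1
        stage := Stage.update s δ' c.fval fp false }
  | accept (c : Config n) (s : Vec n) (δ' f0 fp : ℝ) (b : Bool) (σ' : ℝ)
      (hc : c.stage = Stage.update s δ' f0 fp b)
      (hρ : P.η₁ ≤ (f0 - fp) / taylorDecrease c.D P.p s)
      (hσ : SigmaUpdate P ((f0 - fp) / taylorDecrease c.D P.p s) c.σ σ') :
      Step c { c with
        iter := c.iter + 1
        x := c.x + s
        σ := σ'
        δ := δ'
        got := fun _ => ⊤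
        fval := fp
        fgot := (fAcc P c s : WithTop ℝ)
        stage := Stage.start }
  | reject (c : Config n) (s : Vec n) (δ' f0 fp : ℝ) (b : Bool) (σ' : ℝ)
      (hc : c.stage = Stage.update s δ' f0 fp b)
      (hρ : (f0 - fp) / taylorDecrease c.D P.p s < P.η₁)
      (hσ : SigmaUpdate P ((f0 - fp) / taylorDecrease c.D P.p s) c.σ σ') :
      Step c { c with
        iter := c.iter + 1
        σ := σ'
        δ := δ'
        fval := f0
        fgot := (fAcc P c s : WithTop ℝ)
        stage := Stage.start }
  | halted (c : Config n) (hc : c.stage = Stage.stop1 ∨ ∃ s, c.stage = Stage.stop2 s) :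
      Step c c

/-- A run of the algorithm from `x₀` with accuracy level `ε`; a terminated run stays constant. -/
def IsRun (x₀ : Vec n) (ρ : ℕ → Config n) : Prop :=
  ρ 0 = Config.initial P x₀ ∧ ∀ m, Step P F ε (ρ m) (ρ (m + 1))

end Steps

/-- The `p + q + 2` accuracy requirements of one iteration: the derivatives of orders `1, …, q` in
the last pass of Step 1, those of orders `1, …, p` in the last pass of Step 2, and the two function
values (`0` for the trial point, `1` for the iterate). -/
abbrev Requirement (P : Params) := Fin P.q ⊕ Fin P.p ⊕ Fin 2

/-- Requirement `i` is met in iteration `k` of the run `ρ`: if the corresponding quantity is newly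
evaluated in that iteration (for derivatives: in the last pass of the relevant step), its error is
within the requested bound. -/
def Meets (P : Params) {n : ℕ} (f : Vec n → ℝ) (ρ : ℕ → Config n) (k : ℕ) :
    Requirement P → Prop
  | Sum.inl j => ∀ m, (ρ m).iter = k → (ρ m).stage = Stage.check1 →
      (ρ (m + 1)).stage ≠ Stage.eval1 → (j : ℕ) + 1 ∈ (ρ m).fresh →
      ‖(ρ m).D (j + 1) - derivs f (ρ m).x (j + 1)‖ ≤ (ρ m).acc (j + 1)
  | Sum.inr (Sum.inl j) => ∀ m, (ρ m).iter = k → (ρ m).stage = Stage.check2 →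
      (ρ (m + 1)).stage ≠ Stage.eval2 → (j : ℕ) + 1 ∈ (ρ m).fresh →
      ‖(ρ m).D (j + 1) - derivs f (ρ m).x (j + 1)‖ ≤ (ρ m).acc (j + 1)
  | Sum.inr (Sum.inr 0) => ∀ m s δ' f0 fp b, (ρ m).iter = k →
      (ρ m).stage = Stage.update s δ' f0 fp b →
      |fp - f ((ρ m).x + s)| ≤ fAcc P (ρ m) s
  | Sum.inr (Sum.inr 1) => ∀ m s δ' f0 fp, (ρ m).iter = k →
      (ρ m).stage = Stage.update s δ' f0 fp true →
      |f0 - f (ρ m).x| ≤ fAcc P (ρ m) s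

/-- The run has terminated in configuration `c` with an acceptable approximate minimizer: either
`c.x` is an `(ε, δ)`-approximate `q`-th-order-necessary minimizer for some `δ ∈ (0, 1]`, or the run
has terminated in Step 2 with a nonzero global model minimizer `s` and
`φ_{f,p}^{‖s‖}(x) ≤ ε χ_p(‖s‖)`. -/
def Solved (P : Params) {n : ℕ} (F : Set (Vec n)) (f : Vec n → ℝ) (ε : ℝ) (c : Config n) : Prop :=
  c.x ∈ F ∧
  (((c.stage = Stage.stop1 ∨ ∃ s, c.stage = Stage.stop2 s) ∧
      ∃ δ ∈ Ioc (0 : ℝ) 1, phi F (derivs f c.x) P.q c.x δ ≤ ε * chi P.q δ) ∨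
    ∃ s, c.stage = Stage.stop2 s ∧ s ≠ 0 ∧
      phi F (derivs f c.x) P.p c.x ‖s‖ ≤ ε * chi P.p ‖s‖)

end ARpDA

/-! The probabilistic part is a union bound: with `B = iterConst * ε ^ (-rate)`, all accuracy
requirements of the iterations `k ≤ B` are met outside an event of probability at most `(⌊B⌋ + 1) (p
+ q + 2) t ≤ tbar`. What remains is deterministic: a run that meets these requirements terminates
correctly within the bounds.

Progress. If Step 1 does not stop at `x`, the true optimality measure exceeds a fixed fraction of `ε
χ_q(δ)` (`lt_phi_of_pass1`). If `x` was reached by a short step `s`, the step test, the Taylor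
remainder and the derivatives of `‖·‖^{p+β}` bound that measure by `(const ‖s‖^{p-q+β} + ξ_model)
χ_q(δ)` (`goodStep_of_candidate`). Hence `‖s‖` is at least of order `ε^{1/(p-q+β)}`, and the step,
being successful, has decreased `f` by at least a multiple of `ε^{(p+β)/(p-q+β)}`
(`decConst_le_of_goodStep`). Boundedness below limits the successful iterations. Above `sigmaBar`
every step is very successful, so `σ` stays bounded; as each failure multiplies `σ` by at least
`γ₂`, the failures are bounded linearly in the successes (`iter_le_of_counts`).

Inner loops. VERIFY can return 0 only while some requested accuracy exceeds a fixed multiple of `ε`,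
so an iteration has `O(1 + |log ε|)` reductions (`succ_le_maxRetries`).

Termination. Flags 1 and 3, or a passed test with flag 2, transfer from the inexact to the exact
measure (`phi_le_of_stop1`, `solved_of_stop2`).

All this is carried by the invariant `RunInv`, which each transition preserves unless it ends the
run (`RunInv.step`). The invariant itself implies `iter ≤ B`, so the requirements for the next
transition are always available. -/

namespace ARpDA

/-! ### Symmetry of iterated derivatives and the Taylor remainder. -/

section Smooth

variable {E : Type*} [NormedAddCommGroup E] [NormedSpace ℝ E]

theorem fderiv_iteratedFDeriv_apply {f : E → ℝ} {m : ℕ}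
    (hf : ContDiff ℝ ((m + 1 : ℕ) : WithTop ℕ∞) f) (x u : E) (w : Fin m → E) :
    fderiv ℝ (fun y => iteratedFDeriv ℝ m f y w) x u
      = fderiv ℝ (iteratedFDeriv ℝ m f) x u w := by
  have hd : DifferentiableAt ℝ (iteratedFDeriv ℝ m f) x :=
    (hf.differentiable_iteratedFDeriv (by exact_mod_cast Nat.lt_succ_self m)) x
  have := (ContinuousMultilinearMap.apply ℝ (fun _ : Fin m => E) ℝ w).hasFDerivAt.comp x
    hd.hasFDerivAt
  have h2 := this.fderiv
  have h3 : (fun y => iteratedFDeriv ℝ m f y w)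
      = (ContinuousMultilinearMap.apply ℝ (fun _ : Fin m => E) ℝ w) ∘ iteratedFDeriv ℝ m f := rfl
  rw [h3, h2]; rfl

/-- The first two arguments are those of the second derivative of the `C²` map `iteratedFDeriv ℝ m
f`, so Schwarz's theorem applies. -/
theorem iteratedFDeriv_swap_zero_one {f : E → ℝ} {m : ℕ}
    (hf : ContDiff ℝ ((m + 2 : ℕ) : WithTop ℕ∞) f) (x : E) (v : Fin (m + 2) → E) :
    iteratedFDeriv ℝ (m + 2) f x (v ∘ Equiv.swap 0 1) = iteratedFDeriv ℝ (m + 2) f x v := by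
  have hg : ContDiff ℝ 2 (fun y => iteratedFDeriv ℝ m f y) := by
    refine ContDiff.iteratedFDeriv_right (m := 2) hf ?_
    norm_cast
    omega
  have key : ∀ v : Fin (m + 2) → E, iteratedFDeriv ℝ (m + 2) f x v
      = fderiv ℝ (fderiv ℝ (iteratedFDeriv ℝ m f)) x (v 0) (v 1)
          (Fin.tail (Fin.tail v)) := by
    intro v
    rw [iteratedFDeriv_succ_apply_left]
    have h1 : fderiv ℝ (iteratedFDeriv ℝ (m + 1) f) x (v 0) (Fin.tail v)
        = fderiv ℝ (fun y => iteratedFDeriv ℝ (m + 1) f y (Fin.tail v)) x (v 0) :=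
      (fderiv_iteratedFDeriv_apply hf x (v 0) (Fin.tail v)).symm
    rw [h1]
    have h2 : (fun y => iteratedFDeriv ℝ (m + 1) f y (Fin.tail v))
        = fun y => fderiv ℝ (iteratedFDeriv ℝ m f) y (v 1) (Fin.tail (Fin.tail v)) := by
      funext y
      rw [iteratedFDeriv_succ_apply_left]
      rfl
    rw [h2]
    have hd : DifferentiableAt ℝ (fderiv ℝ (iteratedFDeriv ℝ m f)) x :=
      ((hg.fderiv_right (m := 1) (by norm_num)).differentiable one_ne_zero) x
    have h3 : HasFDerivAt (fun y => fderiv ℝ (iteratedFDeriv ℝ m f) y (v 1))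
        ((fderiv ℝ (fderiv ℝ (iteratedFDeriv ℝ m f)) x).flip (v 1)) x := by
      simpa using hd.hasFDerivAt.clm_apply (hasFDerivAt_const (v 1) x)
    have h4 := ((ContinuousMultilinearMap.apply ℝ (fun _ : Fin m => E) ℝ
      (Fin.tail (Fin.tail v))).hasFDerivAt.comp x h3).fderiv
    exact congrArg (fun T => T (v 0)) h4
  rw [key, key]
  have hsym : IsSymmSndFDerivAt ℝ (iteratedFDeriv ℝ m f) x :=
    (hg.contDiffAt).isSymmSndFDerivAt (by simp)
  have ht : Fin.tail (Fin.tail (v ∘ Equiv.swap 0 1)) = Fin.tail (Fin.tail v) := by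
    funext i
    simp only [Fin.tail, Function.comp]
    rw [Equiv.swap_apply_of_ne_of_ne (Fin.succ_ne_zero _)]
    intro h
    have := congrArg Fin.val h
    simp at this
  rw [ht]
  simp only [Function.comp, Equiv.swap_apply_left, Equiv.swap_apply_right]
  rw [hsym.eq]

/-- Induction on the order: a swap not involving slot 0 is a swap for the derivative of one order
less, and that identity holds at every point, so it can be differentiated in the direction `v 0`. -/
theorem iteratedFDeriv_comp_swap {f : E → ℝ} : ∀ {m : ℕ}
    (_ : ContDiff ℝ ((m + 1 : ℕ) : WithTop ℕ∞) f) (x : E) (v : Fin (m + 1) → E) (i : Fin m),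
    iteratedFDeriv ℝ (m + 1) f x (v ∘ Equiv.swap i.castSucc i.succ)
      = iteratedFDeriv ℝ (m + 1) f x v := by
  intro m
  induction m with
  | zero => intro _ _ _ i; exact i.elim0
  | succ m ih =>
    intro hf x v i
    refine Fin.cases ?_ (fun j => ?_) i
    · exact iteratedFDeriv_swap_zero_one hf x v
    · have hf' : ContDiff ℝ ((m + 1 : ℕ) : WithTop ℕ∞) f := hf.of_le (by norm_cast; omega)
      rw [iteratedFDeriv_succ_apply_left, iteratedFDeriv_succ_apply_left,
        ← fderiv_iteratedFDeriv_apply hf, ← fderiv_iteratedFDeriv_apply hf]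
      have h0 : (v ∘ Equiv.swap j.succ.castSucc j.succ.succ) 0 = v 0 := by
        simp only [Function.comp]
        rw [Equiv.swap_apply_of_ne_of_ne]
        · rw [← Fin.succ_castSucc]; exact (Fin.succ_ne_zero _).symm
        · exact (Fin.succ_ne_zero _).symm
      have ht : Fin.tail (v ∘ Equiv.swap j.succ.castSucc j.succ.succ)
          = Fin.tail v ∘ Equiv.swap j.castSucc j.succ := by
        funext l
        simp only [Fin.tail, Function.comp]
        rw [← Fin.succ_castSucc, ← (Fin.succ_injective (m + 1)).swap_apply]
      rw [h0]
      have : (fun y => iteratedFDeriv ℝ (m + 1) f y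
            (Fin.tail (v ∘ Equiv.swap j.succ.castSucc j.succ.succ)))
          = fun y => iteratedFDeriv ℝ (m + 1) f y (Fin.tail v) := by
        funext y
        rw [ht, ih hf' y (Fin.tail v) j]
      exact congrArg (fun g => fderiv ℝ g x (v 0)) this

/-- The iterated derivatives of a `Cᵐ` function are symmetric up to order `m`. -/
theorem iteratedFDeriv_comp_perm_of_contDiff {f : E → ℝ} {m : ℕ}
    (hf : ContDiff ℝ (m : WithTop ℕ∞) f) (x : E) (v : Fin m → E) (σ : Equiv.Perm (Fin m)) :
    iteratedFDeriv ℝ m f x (v ∘ σ) = iteratedFDeriv ℝ m f x v := by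
  cases m with
  | zero => congr 1; exact Subsingleton.elim _ _
  | succ m =>
    -- Adjacent transpositions generate the symmetric group.
    have hmem : σ ∈ Submonoid.closure
        (Set.range fun i : Fin m => Equiv.swap i.castSucc i.succ) := by
      rw [Equiv.Perm.mclosure_swap_castSucc_succ]; trivial
    induction hmem using Submonoid.closure_induction generalizing v with
    | mem τ hτ => obtain ⟨i, rfl⟩ := hτ; exact iteratedFDeriv_comp_swap hf x v i
    | one => rfl
    | mul a b _ _ iha ihb =>
      have : v ∘ ⇑(a * b) = (v ∘ a) ∘ b := rfl
      rw [this, ihb, iha]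

/-- The polynomial `T_p(s) = ∑_{j ≤ p} D_j[s]^j / j!` with given tensors. -/
noncomputable def tensorPoly (D : ∀ j, ContinuousMultilinearMap ℝ (fun _ : Fin j => E) ℝ) (p : ℕ)
    (s : E) : ℝ :=
  ∑ j ∈ Finset.range (p + 1), ((j.factorial : ℝ)⁻¹) • D j (fun _ => s)

theorem contDiff_diagonal {j : ℕ} (A : ContinuousMultilinearMap ℝ (fun _ : Fin j => E) ℝ)
    {N : WithTop ℕ∞} : ContDiff ℝ N (fun s : E => A (fun _ => s)) :=
  A.contDiff.comp (contDiff_pi.2 fun _ => contDiff_id)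

/-- The map is `A` composed with the diagonal embedding, which has norm at most 1 for the sup norm.
For `l > j` the truncated exponent is harmless because `descFactorial` vanishes. -/
theorem norm_iteratedFDeriv_diagonal_le {j : ℕ}
    (A : ContinuousMultilinearMap ℝ (fun _ : Fin j => E) ℝ) (l : ℕ) (s : E) :
    ‖iteratedFDeriv ℝ l (fun s : E => A (fun _ => s)) s‖
      ≤ (j.descFactorial l : ℝ) * ‖A‖ * ‖s‖ ^ (j - l) := by
  let g : E →L[ℝ] (Fin j → E) := ContinuousLinearMap.pi (fun _ ↦ ContinuousLinearMap.id ℝ E)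
  have hg : ‖g‖ ≤ 1 := by
    refine g.opNorm_le_bound zero_le_one fun y => ?_
    rw [one_mul, pi_norm_le_iff_of_nonneg (norm_nonneg _)]
    intro i
    rfl
  have hgs : ‖g s‖ ≤ ‖s‖ := (g.le_opNorm s).trans (mul_le_of_le_one_left (norm_nonneg _) hg)
  change ‖iteratedFDeriv ℝ l (A ∘ g) s‖ ≤ _
  rw [ContinuousLinearMap.iteratedFDeriv_comp_right g (n := (l : WithTop ℕ∞)) A.contDiff s le_rfl]
  refine (ContinuousMultilinearMap.norm_compContinuousLinearMap_le _ _).trans ?_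
  have h1 : ∏ _i : Fin l, ‖g‖ ≤ 1 := Finset.prod_le_one (fun _ _ => norm_nonneg _) fun _ _ => hg
  refine (mul_le_of_le_one_right (norm_nonneg _) h1).trans ?_
  refine (A.norm_iteratedFDeriv_le l (g s)).trans ?_
  rw [Fintype.card_fin]
  gcongr

theorem contDiff_tensorPoly (D : ∀ j, ContinuousMultilinearMap ℝ (fun _ : Fin j => E) ℝ) (p : ℕ)
    {N : WithTop ℕ∞} : ContDiff ℝ N (tensorPoly D p) := by
  unfold tensorPoly
  exact ContDiff.sum fun j _ => (contDiff_diagonal (D j)).const_smul _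

theorem iteratedFDeriv_tensorPoly (D : ∀ j, ContinuousMultilinearMap ℝ (fun _ : Fin j => E) ℝ)
    (p l : ℕ) (s : E) : iteratedFDeriv ℝ l (tensorPoly D p) s
      = ∑ j ∈ Finset.range (p + 1), ((j.factorial : ℝ)⁻¹) •
          iteratedFDeriv ℝ l (fun s : E => D j (fun _ => s)) s := by
  unfold tensorPoly
  rw [iteratedFDeriv_fun_sum_apply fun j _ => ((contDiff_diagonal (D j)).const_smul _).contDiffAt]
  refine Finset.sum_congr rfl fun j _ => ?_
  exact iteratedFDeriv_const_smul_apply' (contDiff_diagonal (D j)).contDiffAt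

theorem norm_iteratedFDeriv_tensorPoly_le
    (D : ∀ j, ContinuousMultilinearMap ℝ (fun _ : Fin j => E) ℝ)
    (p l : ℕ) (s : E) : ‖iteratedFDeriv ℝ l (tensorPoly D p) s‖
      ≤ ∑ j ∈ Finset.range (p + 1), ((j.factorial : ℝ)⁻¹) *
          ((j.descFactorial l : ℝ) * ‖D j‖ * ‖s‖ ^ (j - l)) := by
  rw [iteratedFDeriv_tensorPoly]
  refine (norm_sum_le _ _).trans (Finset.sum_le_sum fun j _ => ?_)
  rw [norm_smul, Real.norm_of_nonneg (by positivity)]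
  gcongr
  exact norm_iteratedFDeriv_diagonal_le _ _ _

theorem iteratedFDeriv_diagonal_of_ne {j l : ℕ}
    (A : ContinuousMultilinearMap ℝ (fun _ : Fin j => E) ℝ) (h : j ≠ l) :
    iteratedFDeriv ℝ l (fun s : E => A (fun _ => s)) 0 = 0 := by
  rw [← norm_le_zero_iff]
  refine (norm_iteratedFDeriv_diagonal_le A l 0).trans ?_
  rcases lt_or_gt_of_ne h with h | h
  · simp [Nat.descFactorial_of_lt h]
  · simp [Nat.sub_ne_zero_of_lt h]

/-- The `j`-th derivative of a diagonal is the sum of the tensor over all permutations of its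
arguments; symmetry makes the `j!` terms equal. -/
theorem iteratedFDeriv_diagonal_symm {f : E → ℝ} {j : ℕ}
    (hf : ContDiff ℝ (j : WithTop ℕ∞) f) (x s : E) :
    iteratedFDeriv ℝ j (fun s : E => iteratedFDeriv ℝ j f x (fun _ => s)) s
      = (j.factorial : ℝ) • iteratedFDeriv ℝ j f x := by
  ext v
  rw [ContinuousMultilinearMap.iteratedFDeriv_comp_diagonal]
  have : ∀ σ : Equiv.Perm (Fin j), iteratedFDeriv ℝ j f x (fun i => v (σ i))
      = iteratedFDeriv ℝ j f x v := fun σ => iteratedFDeriv_comp_perm_of_contDiff hf x v σ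
  simp [this, Fintype.card_perm]

/-- The derivatives of the Taylor remainder of a function with Hölder continuous `p`-th
derivative. -/
theorem norm_iteratedFDeriv_taylor_remainder_le {f : E → ℝ} {p : ℕ} {β L : ℝ} (hβ : 0 ≤ β)
    (hL : 0 ≤ L) (hf : ContDiff ℝ (p : WithTop ℕ∞) f)
    (hH : ∀ x y, ‖iteratedFDeriv ℝ p f x - iteratedFDeriv ℝ p f y‖ ≤ L * ‖x - y‖ ^ β)
    (x : E) : ∀ i ≤ p, ∀ s : E,
      ‖iteratedFDeriv ℝ (p - i) f (x + s)
          - iteratedFDeriv ℝ (p - i) (tensorPoly (fun j => iteratedFDeriv ℝ j f x) p) s‖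
        ≤ L * ‖s‖ ^ ((i : ℝ) + β) := by
  set T := tensorPoly (fun j => iteratedFDeriv ℝ j f x) p with hT
  have hTs : ∀ {N : WithTop ℕ∞}, ContDiff ℝ N T := contDiff_tensorPoly _ _
  have hfl : ∀ l ≤ p, ContDiff ℝ (l : WithTop ℕ∞) f := fun l hl =>
    hf.of_le (by exact_mod_cast hl)
  have hT0 : ∀ l ≤ p, iteratedFDeriv ℝ l T 0 = iteratedFDeriv ℝ l f x := by
    intro l hl
    rw [hT, iteratedFDeriv_tensorPoly, Finset.sum_eq_single l]
    · rw [iteratedFDeriv_diagonal_symm (hfl l hl), smul_smul, inv_mul_cancel₀, one_smul]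
      positivity
    · intro j _ hj
      rw [iteratedFDeriv_diagonal_of_ne _ hj, smul_zero]
    · intro h
      exact absurd (Finset.mem_range.2 (Nat.lt_succ_of_le hl)) h
  have hTp : ∀ s, iteratedFDeriv ℝ p T s = iteratedFDeriv ℝ p f x := by
    intro s
    rw [hT, iteratedFDeriv_tensorPoly, Finset.sum_eq_single p]
    · rw [iteratedFDeriv_diagonal_symm hf, smul_smul, inv_mul_cancel₀, one_smul]
      positivity
    · intro j hj hjp
      have hlt : j < p := lt_of_le_of_ne (Nat.lt_succ_iff.1 (Finset.mem_range.1 hj)) hjp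
      have : iteratedFDeriv ℝ p (fun s : E => iteratedFDeriv ℝ j f x (fun _ => s)) s = 0 := by
        rw [← norm_le_zero_iff]
        refine (norm_iteratedFDeriv_diagonal_le _ _ _).trans ?_
        simp [Nat.descFactorial_of_lt hlt]
      rw [this, smul_zero]
    · intro h; exact absurd (Finset.mem_range.2 (Nat.lt_succ_self p)) h
  -- Downward induction on the order `p - i` of the derivative: `i = 0` is the Hölder condition,
  -- since the `p`-th derivative of `T` is constant. The mean value inequality on the ball of radius
  -- `‖s‖` then gains one factor `‖s‖` per step. The factorials in the denominators are given up, so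
  -- the constant stays `L`.
  intro i
  induction i with
  | zero =>
    intro _ s
    rw [Nat.sub_zero, hTp]
    simpa using hH (x + s) x
  | succ i ih =>
    intro hi s
    set l := p - (i + 1) with hl
    have hl1 : p - i = l + 1 := by omega
    have hlp : l < p := by omega
    set g : E → E [×l]→L[ℝ] ℝ := fun s => iteratedFDeriv ℝ l f (x + s) - iteratedFDeriv ℝ l T s
      with hg
    have hdf : Differentiable ℝ (iteratedFDeriv ℝ l f) :=
      hf.differentiable_iteratedFDeriv (by exact_mod_cast hlp)
    have hdT : Differentiable ℝ (iteratedFDeriv ℝ l T) :=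
      (hTs (N := (p : WithTop ℕ∞))).differentiable_iteratedFDeriv (by exact_mod_cast hlp)
    have hdfx : Differentiable ℝ (fun s => iteratedFDeriv ℝ l f (x + s)) :=
      hdf.comp ((differentiable_const x).add differentiable_id)
    have hfd : ∀ y, ‖fderiv ℝ g y‖ ≤ L * ‖y‖ ^ ((i : ℝ) + β) := by
      intro y
      have h1 := ih (by omega) y
      rw [hl1] at h1
      have h2 : fderiv ℝ g y = fderiv ℝ (iteratedFDeriv ℝ l f) (x + y)
          - fderiv ℝ (iteratedFDeriv ℝ l T) y := by
        rw [hg, fderiv_fun_sub (hdfx y) (hdT y), fderiv_comp_add_left]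
      rw [h2]
      have h3 := congrFun (iteratedFDeriv_succ_eq_comp_left (𝕜 := ℝ) (f := f) (n := l)) (x + y)
      have h4 := congrFun (iteratedFDeriv_succ_eq_comp_left (𝕜 := ℝ) (f := T) (n := l)) y
      simp only [Function.comp] at h3 h4
      rw [h3, h4, ← dist_eq_norm, LinearIsometryEquiv.dist_map, dist_eq_norm] at h1
      exact h1
    have hg0 : g 0 = 0 := by simp [hg, hT0 l hlp.le]
    have hmv := (convex_closedBall (0 : E) ‖s‖).norm_image_sub_le_of_norm_fderiv_le
      (f := g) (C := L * ‖s‖ ^ ((i : ℝ) + β)) (x := 0) (y := s) (𝕜 := ℝ)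
      (fun y _ => (hdfx y).sub (hdT y))
      (fun y hy => (hfd y).trans (by
        have : ‖y‖ ≤ ‖s‖ := by simpa using hy
        gcongr))
      (by simp) (by simp)
    rw [hg0, sub_zero, sub_zero] at hmv
    refine hmv.trans (le_of_eq ?_)
    rw [mul_assoc]
    congr 1
    rcases eq_or_ne ‖s‖ 0 with h0 | h0
    · rw [h0, mul_zero, Real.zero_rpow]
      push_cast
      positivity
    · have hpos : 0 < ‖s‖ := lt_of_le_of_ne (norm_nonneg _) h0.symm
      rw [show (((i + 1 : ℕ) : ℝ) + β) = ((i : ℝ) + β) + 1 by push_cast; ring,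
        Real.rpow_add_one hpos.ne']

end Smooth

/-! ### Derivatives of powers of the norm. -/

section NormPower

variable {E : Type*} [NormedAddCommGroup E] [InnerProductSpace ℝ E]

/-- The squared norm is the diagonal of the inner product, a bilinear form of norm at most 1. -/
theorem norm_iteratedFDeriv_norm_sq_le (s : E) (l : ℕ) :
    ‖iteratedFDeriv ℝ l (fun y : E => ‖y‖ ^ 2) s‖
      ≤ (Nat.descFactorial 2 l : ℝ) * ‖s‖ ^ (2 - l) := by
  let e := (continuousMultilinearCurryFin1 ℝ E ℝ).symm
  let A : ContinuousMultilinearMap ℝ (fun _ : Fin 2 => E) ℝ :=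
    (((e : (E →L[ℝ] ℝ) →L[ℝ] E [×1]→L[ℝ] ℝ)).comp (innerSL ℝ)).uncurryLeft
  have hA : ‖A‖ ≤ 1 := by
    rw [ContinuousLinearMap.uncurryLeft_norm]
    refine ContinuousLinearMap.opNorm_le_bound _ zero_le_one fun y => ?_
    have : ‖e (innerSL ℝ y)‖ = ‖y‖ := by rw [LinearIsometryEquiv.norm_map, innerSL_apply_norm]
    rw [one_mul]
    exact this.le
  have hAe : (fun y : E => ‖y‖ ^ 2) = fun y => A (fun _ => y) := by
    funext y
    exact (real_inner_self_eq_norm_sq y).symm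
  rw [hAe]
  refine (norm_iteratedFDeriv_diagonal_le A l s).trans ?_
  have : (0 : ℝ) ≤ (Nat.descFactorial 2 l : ℝ) := by positivity
  gcongr
  exact mul_le_of_le_one_right this hA

/-- A bound, independent of the space, of the derivatives of `‖·‖ ^ r` of order at most `q` on the
unit sphere. -/
noncomputable def normPowConst (r : ℝ) (q : ℕ) : ℝ :=
  (q.factorial : ℝ) *
    (∑ i ∈ Finset.range (q + 1), ‖iteratedFDeriv ℝ i (fun t : ℝ => t ^ (r / 2)) 1‖) * 2 ^ q

theorem normPowConst_nonneg (r : ℝ) (q : ℕ) : 0 ≤ normPowConst r q := by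
  unfold normPowConst
  have := Finset.sum_nonneg (s := Finset.range (q + 1))
    fun i _ => norm_nonneg (iteratedFDeriv ℝ i (fun t : ℝ => t ^ (r / 2)) 1)
  positivity

theorem contDiffAt_norm_rpow {s : E} (hs : s ≠ 0) (r : ℝ) {N : WithTop ℕ∞} :
    ContDiffAt ℝ N (fun y : E => ‖y‖ ^ r) s :=
  (Real.contDiffAt_rpow_const_of_ne (norm_ne_zero_iff.2 hs)).comp s (contDiffAt_norm ℝ hs)

/-- Rescaling by homogeneity: `‖y‖^r = ‖s‖^r g(h y)` with `g t = t^{r/2}` and `h y = ‖y‖²/‖s‖²`. As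
`h s = 1`, only the derivatives of the one-variable function `g` at 1 enter, and the `i`-th
derivative of `h` at `s` is at most `(2/‖s‖)^i`. The resulting constant does not depend on the
dimension, as the final constants must not. -/
theorem norm_iteratedFDeriv_norm_rpow_le (r : ℝ) {q l : ℕ} (hl : l ≤ q) {s : E} (hs : s ≠ 0) :
    ‖iteratedFDeriv ℝ l (fun y : E => ‖y‖ ^ r) s‖ ≤ normPowConst r q * ‖s‖ ^ (r - l) := by
  have hpos : 0 < ‖s‖ := norm_pos_iff.2 hs
  set g : ℝ → ℝ := fun t => t ^ (r / 2) with hg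
  set h : E → ℝ := fun y => (‖s‖ ^ 2)⁻¹ • ‖y‖ ^ 2 with hh
  set C := ∑ i ∈ Finset.range (q + 1), ‖iteratedFDeriv ℝ i g 1‖ with hC
  have hC0 : 0 ≤ C := Finset.sum_nonneg fun i _ => norm_nonneg _
  have hU : IsOpen {y : E | y ≠ 0} := isOpen_ne
  have hh1 : h s = 1 := by simp [hh, hpos.ne']
  have hfun : (fun y : E => ‖y‖ ^ r) = fun y => (‖s‖ ^ r) • (g ∘ h) y := by
    funext y
    have h1 : h y = (‖s‖⁻¹ * ‖y‖) ^ (2 : ℝ) := by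
      simp only [hh, smul_eq_mul]
      norm_cast
      rw [mul_pow, inv_pow]
    simp only [Function.comp, hg, h1, smul_eq_mul]
    rw [← Real.rpow_mul (by positivity), mul_div_cancel₀ r two_ne_zero,
      Real.mul_rpow (by positivity) (by positivity), Real.inv_rpow (by positivity)]
    have : ‖s‖ ^ r ≠ 0 := (Real.rpow_pos_of_pos hpos r).ne'
    field_simp
  have hgc : ContDiffOn ℝ (l : WithTop ℕ∞) g (Ioi 0) := fun t ht =>
    (Real.contDiffAt_rpow_const_of_ne (ne_of_gt ht)).contDiffWithinAt
  have hhc : ContDiff ℝ (l : WithTop ℕ∞) h := (contDiff_norm_sq ℝ).const_smul _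
  have hmaps : MapsTo h {y : E | y ≠ 0} (Ioi 0) := fun y hy => by
    have : 0 < ‖y‖ := norm_pos_iff.2 hy
    simp only [hh, smul_eq_mul, mem_Ioi]
    positivity
  have hcomp : ‖iteratedFDeriv ℝ l (g ∘ h) s‖ ≤ l.factorial * C * (2 * ‖s‖⁻¹) ^ l := by
    have := norm_iteratedFDerivWithin_comp_le (𝕜 := ℝ) (n := l) hgc hhc.contDiffOn le_rfl
      isOpen_Ioi.uniqueDiffOn hU.uniqueDiffOn hmaps (x := s) hs (C := C) (D := 2 * ‖s‖⁻¹)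
      (fun i hi => by
        rw [hh1, iteratedFDerivWithin_of_isOpen i isOpen_Ioi (by simp)]
        exact Finset.single_le_sum (f := fun i => ‖iteratedFDeriv ℝ i g 1‖)
          (fun i _ => norm_nonneg _) (Finset.mem_range.2 (by omega)))
      (fun i hi1 _ => by
        rw [iteratedFDerivWithin_of_isOpen i hU hs]
        have : iteratedFDeriv ℝ i h s
            = (‖s‖ ^ 2)⁻¹ • iteratedFDeriv ℝ i (fun y : E => ‖y‖ ^ 2) s :=
          iteratedFDeriv_const_smul_apply' (contDiff_norm_sq ℝ).contDiffAt
        rw [this, norm_smul, Real.norm_of_nonneg (by positivity)]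
        have hb := norm_iteratedFDeriv_norm_sq_le s i
        rcases (by omega : i = 1 ∨ i = 2 ∨ 3 ≤ i) with rfl | rfl | h3
        · calc (‖s‖ ^ 2)⁻¹ * _ ≤ (‖s‖ ^ 2)⁻¹ * ((Nat.descFactorial 2 1 : ℝ) * ‖s‖ ^ (2 - 1)) := by
                gcongr
            _ = (2 * ‖s‖⁻¹) ^ 1 := by
                simp [Nat.descFactorial]; field_simp
        · calc (‖s‖ ^ 2)⁻¹ * _ ≤ (‖s‖ ^ 2)⁻¹ * ((Nat.descFactorial 2 2 : ℝ) * ‖s‖ ^ (2 - 2)) := by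
                gcongr
            _ ≤ (2 * ‖s‖⁻¹) ^ 2 := by
                simp [Nat.descFactorial, mul_pow]
                have : 0 < (‖s‖ ^ 2)⁻¹ := by positivity
                linarith
        · rw [Nat.descFactorial_of_lt (by omega), Nat.cast_zero, zero_mul] at hb
          calc (‖s‖ ^ 2)⁻¹ * _ ≤ (‖s‖ ^ 2)⁻¹ * 0 := by gcongr
            _ ≤ _ := by rw [mul_zero]; positivity)
    rwa [iteratedFDerivWithin_of_isOpen l hU hs] at this
  have hgh : ContDiffAt ℝ (l : WithTop ℕ∞) (g ∘ h) s := by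
    refine ContDiffAt.comp s ?_ hhc.contDiffAt
    rw [hh1]
    exact Real.contDiffAt_rpow_const_of_ne one_ne_zero
  rw [hfun, iteratedFDeriv_const_smul_apply' hgh, norm_smul, Real.norm_of_nonneg (by positivity),
    Real.rpow_sub hpos, Real.rpow_natCast]
  calc ‖s‖ ^ r * _ ≤ ‖s‖ ^ r * (l.factorial * C * (2 * ‖s‖⁻¹) ^ l) := by gcongr
    _ = (l.factorial * C * 2 ^ l) * (‖s‖ ^ r / ‖s‖ ^ l) := by
        rw [mul_pow, inv_pow]; ring
    _ ≤ normPowConst r q * (‖s‖ ^ r / ‖s‖ ^ l) := by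
        have h2 : (2 : ℝ) ^ l ≤ 2 ^ q := pow_le_pow_right₀ (by norm_num) hl
        have h3 : (l.factorial : ℝ) ≤ q.factorial := by exact_mod_cast Nat.factorial_le hl
        have : (l.factorial : ℝ) * C * 2 ^ l ≤ normPowConst r q := by
          unfold normPowConst
          gcongr
        gcongr

end NormPower

/-! ### Taylor increments and their perturbation. -/

theorem fracFactorial_pos (i : ℕ) {β : ℝ} (hβ : 0 < β) : 0 < fracFactorial i β :=
  Finset.prod_pos fun l _ => by positivity

theorem chi_pos {r : ℕ} (hr : 1 ≤ r) {δ : ℝ} (hδ : 0 < δ) : 0 < chi r δ :=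
  Finset.sum_pos (fun l _ => by positivity) ⟨1, Finset.mem_Icc.2 ⟨le_rfl, hr⟩⟩

theorem chi_nonneg (r : ℕ) {δ : ℝ} (hδ : 0 ≤ δ) : 0 ≤ chi r δ :=
  Finset.sum_nonneg fun l _ => by positivity

theorem sum_div_factorial_mul_pow_le {r : ℕ} {ζ : ℕ → ℝ} {ξ δ : ℝ} (hδ : 0 ≤ δ)
    (h : ∀ j ∈ Finset.Icc 1 r, ζ j ≤ ξ) :
    ∑ j ∈ Finset.Icc 1 r, ζ j / (j.factorial : ℝ) * δ ^ j ≤ ξ * chi r δ := by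
  rw [chi, Finset.mul_sum]
  refine Finset.sum_le_sum fun j hj => ?_
  have : 0 ≤ δ ^ j / (j.factorial : ℝ) := by positivity
  calc ζ j / (j.factorial : ℝ) * δ ^ j = ζ j * (δ ^ j / (j.factorial : ℝ)) := by ring
    _ ≤ _ := mul_le_mul_of_nonneg_right (h j hj) this

section Increments

variable {n : ℕ}

theorem abs_tensor_diag_le {j : ℕ} (A : Tensor n j) (d : Vec n) :
    |A (fun _ => d)| ≤ ‖A‖ * ‖d‖ ^ j := by
  have := A.le_opNorm (fun _ => d)
  simpa using this

theorem abs_taylorDecrease_sub_le {D D' : ∀ j, Tensor n j} {r : ℕ} {ζ : ℕ → ℝ} {δ : ℝ}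
    (h : ∀ j ∈ Finset.Icc 1 r, ‖D j - D' j‖ ≤ ζ j) {d : Vec n} (hd : ‖d‖ ≤ δ) :
    |taylorDecrease D r d - taylorDecrease D' r d|
      ≤ ∑ j ∈ Finset.Icc 1 r, ζ j / (j.factorial : ℝ) * δ ^ j := by
  have : taylorDecrease D r d - taylorDecrease D' r d
      = -∑ j ∈ Finset.Icc 1 r, (D j - D' j) (fun _ => d) / (j.factorial : ℝ) := by
    simp only [taylorDecrease, sub_apply, sub_div, Finset.sum_sub_distrib]
    ring
  rw [this, abs_neg]
  refine (Finset.abs_sum_le_sum_abs _ _).trans (Finset.sum_le_sum fun j hj => ?_)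
  rw [abs_div, Nat.abs_cast, div_mul_eq_mul_div]
  gcongr
  refine (abs_tensor_diag_le _ _).trans ?_
  have := h j hj
  gcongr
  exact (norm_nonneg _).trans this

theorem continuous_taylorDecrease (D : ∀ j, Tensor n j) (r : ℕ) :
    Continuous (taylorDecrease D r) := by
  unfold taylorDecrease
  refine (continuous_finsetSum _ fun j _ => ?_).neg
  exact ((D j).cont.comp (continuous_pi fun _ => continuous_id)).div_const _

theorem taylorDecrease_zero (D : ∀ j, Tensor n j) (r : ℕ) : taylorDecrease D r 0 = 0 := by
  unfold taylorDecrease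
  rw [Finset.sum_eq_zero, neg_zero]
  intro j hj
  have hj1 : 1 ≤ j := (Finset.mem_Icc.1 hj).1
  have := abs_tensor_diag_le (D j) 0
  rw [norm_zero, zero_pow (by omega), mul_zero] at this
  rw [abs_nonpos_iff.1 this, zero_div]

theorem tensorPoly_eq_sub_taylorDecrease (D : ∀ j, Tensor n j) (p : ℕ) (s : Vec n) :
    tensorPoly D p s = D 0 0 - taylorDecrease D p s := by
  unfold tensorPoly taylorDecrease
  rw [Finset.range_eq_Ico, Finset.sum_eq_sum_Ico_succ_bot (Nat.succ_pos p)]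
  have h0 : D 0 (fun _ => s) = D 0 0 := congrArg _ (Subsingleton.elim _ _)
  rw [h0, sub_neg_eq_add]
  congr 1
  · simp
  · refine Finset.sum_congr rfl fun j _ => ?_
    rw [smul_eq_mul, div_eq_inv_mul]

theorem abs_taylor_remainder_le {p : ℕ} {β L : ℝ} (hβ : 0 ≤ β) (hL : 0 ≤ L) {f : Vec n → ℝ}
    (hf : HolderSmooth p β L f) (x s : Vec n) :
    |f x - f (x + s) - taylorDecrease (derivs f x) p s| ≤ L * ‖s‖ ^ ((p : ℝ) + β) := by
  have h := norm_iteratedFDeriv_taylor_remainder_le hβ hL hf.1 hf.2 x p le_rfl s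
  rw [Nat.sub_self, iteratedFDeriv_zero_eq_comp, iteratedFDeriv_zero_eq_comp, ← dist_eq_norm,
    Function.comp, Function.comp, LinearIsometryEquiv.dist_map, Real.dist_eq,
    tensorPoly_eq_sub_taylorDecrease] at h
  rw [abs_sub_comm] at h
  have h0 : iteratedFDeriv ℝ 0 f x 0 = f x := rfl
  rw [h0] at h
  convert h using 2
  unfold derivs
  ring

end Increments

/-- Source of the factor 3 in the accuracies `3 ε_j` of the model check: `e < 3`. -/
theorem sum_inv_factorial_le_three (m : ℕ) :
    ∑ i ∈ Finset.range m, ((i.factorial : ℝ))⁻¹ ≤ 3 := by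
  have h := Real.sum_le_exp_of_nonneg (x := 1) zero_le_one m
  have h2 := Real.exp_one_lt_d9
  have h3 : ∑ i ∈ Finset.range m, ((i.factorial : ℝ))⁻¹
      = ∑ i ∈ Finset.range m, (1 : ℝ) ^ i / (i.factorial : ℝ) :=
    Finset.sum_congr rfl fun i _ => by simp
  linarith

/-! ### Derivatives of the model against those of the objective. -/

section Model

variable {n : ℕ}

theorem tensorPoly_sub (A B : ∀ j, Tensor n j) (p : ℕ) :
    tensorPoly (fun j => A j - B j) p = fun s => tensorPoly A p s - tensorPoly B p s := by
  funext s
  simp [tensorPoly, mul_sub, Finset.sum_sub_distrib]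

/-- Order `j ≥ l` contributes at most `ζ / (j - l)!` in the unit ball, and lower orders contribute
nothing. That one `ζ` serves all `j ≥ l` is where the ordering `ε_j ≤ ε_l` of the accuracies is
needed. -/
theorem norm_iteratedFDeriv_tensorPoly_sub_le {A B : ∀ j, Tensor n j} {p l : ℕ} {ζ : ℝ}
    (hζ : 0 ≤ ζ) (h : ∀ j ∈ Finset.Icc l p, ‖A j - B j‖ ≤ ζ) {s : Vec n} (hs : ‖s‖ ≤ 1) :
    ‖iteratedFDeriv ℝ l (tensorPoly A p) s - iteratedFDeriv ℝ l (tensorPoly B p) s‖ ≤ 3 * ζ := by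
  have h1 : iteratedFDeriv ℝ l (tensorPoly A p) s - iteratedFDeriv ℝ l (tensorPoly B p) s
      = iteratedFDeriv ℝ l (tensorPoly (fun j => A j - B j) p) s := by
    rw [tensorPoly_sub]
    exact (fun_iteratedFDeriv_sub_apply (contDiff_tensorPoly A p).contDiffAt
      (contDiff_tensorPoly B p).contDiffAt).symm
  rw [h1]
  refine (norm_iteratedFDeriv_tensorPoly_le _ p l s).trans ?_
  have h2 : ∀ j ∈ Finset.range (p + 1), ((j.factorial : ℝ)⁻¹) *
          ((j.descFactorial l : ℝ) * ‖A j - B j‖ * ‖s‖ ^ (j - l))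
        ≤ if l ≤ j then ζ * (((j - l).factorial : ℝ))⁻¹ else 0 := by
    intro j hj
    split_ifs with hlj
    · have h3 := h j (Finset.mem_Icc.2 ⟨hlj, by have := Finset.mem_range.1 hj; omega⟩)
      have h4 : ((j - l).factorial : ℝ) * (j.descFactorial l : ℝ) = j.factorial := by
        exact_mod_cast Nat.factorial_mul_descFactorial hlj
      have h5 : ‖s‖ ^ (j - l) ≤ 1 := pow_le_one₀ (norm_nonneg _) hs
      have h6 : (0 : ℝ) < (j - l).factorial := by positivity
      have h7 : (j.factorial : ℝ)⁻¹ * (j.descFactorial l : ℝ) = (((j - l).factorial : ℝ))⁻¹ := by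
        have : (j.factorial : ℝ) ≠ 0 := by positivity
        field_simp
        linarith
      calc _ = ((j.factorial : ℝ)⁻¹ * (j.descFactorial l : ℝ)) * (‖A j - B j‖ * ‖s‖ ^ (j - l)) := by
            ring
        _ ≤ (((j - l).factorial : ℝ))⁻¹ * (ζ * 1) := by
            rw [h7]; gcongr
        _ = _ := by ring
    · rw [Nat.descFactorial_of_lt (by omega)]; simp
  refine (Finset.sum_le_sum h2).trans ?_
  rw [← Finset.sum_filter]
  have h3 : (Finset.range (p + 1)).filter (fun j => l ≤ j) = Finset.Ico l (p + 1) := by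
    ext; simp; omega
  rw [h3, Finset.sum_Ico_eq_sum_range, mul_comm, ← Finset.mul_sum, mul_comm]
  simp only [Nat.add_sub_cancel_left]
  rw [mul_comm]
  calc _ ≤ ζ * 3 := mul_le_mul_of_nonneg_left (sum_inv_factorial_le_three _) hζ
    _ = _ := by ring

theorem iteratedFDeriv_model (P : Params) (D : ∀ j, Tensor n j) (σ : ℝ) {l : ℕ} (hl : 1 ≤ l)
    {s : Vec n} (hs : s ≠ 0) :
    iteratedFDeriv ℝ l (P.model D σ) s = iteratedFDeriv ℝ l (tensorPoly D P.p) s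
      + (σ / fracFactorial P.p P.β) •
        iteratedFDeriv ℝ l (fun y : Vec n => ‖y‖ ^ ((P.p : ℝ) + P.β)) s := by
  have h1 : P.model D σ = fun y => (tensorPoly D P.p y - D 0 0)
      + (σ / fracFactorial P.p P.β) • ‖y‖ ^ ((P.p : ℝ) + P.β) := by
    funext y
    rw [tensorPoly_eq_sub_taylorDecrease, Params.model, smul_eq_mul]
    ring
  have hT : ContDiff ℝ (l : WithTop ℕ∞) (tensorPoly D P.p) := contDiff_tensorPoly D P.p
  have hN : ContDiffAt ℝ (l : WithTop ℕ∞) (fun y : Vec n => ‖y‖ ^ ((P.p : ℝ) + P.β)) s :=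
    contDiffAt_norm_rpow hs _
  rw [h1, fun_iteratedFDeriv_add_apply (hT.sub contDiff_const).contDiffAt (hN.const_smul _),
    iteratedFDeriv_const_smul_apply' hN,
    fun_iteratedFDeriv_sub_apply hT.contDiffAt contDiffAt_const,
    iteratedFDeriv_const_of_ne (by omega)]
  simp

/-- The constant of the bound of the difference between the derivatives of the model and those of
the objective. -/
noncomputable def derivConst (P : Params) (L σ : ℝ) : ℝ :=
  L + σ / fracFactorial P.p P.β * normPowConst ((P.p : ℝ) + P.β) P.q

/-- Three errors add up: inexact tensors, the Taylor remainder of order `‖s‖^{p-l+β}`, and the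
regularization term of order `‖s‖^{p+β-l}`. Since `‖s‖ ≤ 1` and `l ≤ q`, both powers are at most
`‖s‖^{p-q+β}`. -/
theorem norm_modelDerivs_sub_le (P : Params) {L : ℝ} (hL : 0 ≤ L) {f : Vec n → ℝ}
    (hf : HolderSmooth P.p P.β L f) {c : Config n} (hσ : 0 ≤ c.σ)
    (hacc : ∀ j ∈ Finset.Icc 1 P.q, ∀ l ∈ Finset.Icc j P.p, c.acc l ≤ c.acc j)
    (hD : ∀ j ∈ Finset.Icc 1 P.p, ‖c.D j - derivs f c.x j‖ ≤ c.acc j)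
    {s : Vec n} (hs : s ≠ 0) (hs1 : ‖s‖ ≤ 1) {l : ℕ} (hl : l ∈ Finset.Icc 1 P.q) :
    ‖modelDerivs P c s l - derivs f (c.x + s) l‖
      ≤ 3 * c.acc l + derivConst P L c.σ * ‖s‖ ^ P.gapExp := by
  obtain ⟨hl1, hlq⟩ := Finset.mem_Icc.1 hl
  have hlp : l ≤ P.p := hlq.trans P.q_le_p
  have hpos : 0 < ‖s‖ := norm_pos_iff.2 hs
  have hacc0 : 0 ≤ c.acc l :=
    (norm_nonneg _).trans (hD l (Finset.mem_Icc.2 ⟨hl1, hlp⟩))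
  have h1 := norm_iteratedFDeriv_tensorPoly_sub_le (A := c.D) (B := derivs f c.x) (p := P.p)
    (l := l) hacc0 (fun j hj => by
      obtain ⟨hj1, hj2⟩ := Finset.mem_Icc.1 hj
      exact (hD j (Finset.mem_Icc.2 ⟨hl1.trans hj1, hj2⟩)).trans (hacc l hl j hj)) hs1
  have hexp : ∀ r : ℝ, P.gapExp ≤ r → ‖s‖ ^ r ≤ ‖s‖ ^ P.gapExp := fun r hr =>
    Real.rpow_le_rpow_of_exponent_ge hpos hs1 hr
  have hlq' : (l : ℝ) ≤ P.q := by exact_mod_cast hlq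
  have h2 : ‖iteratedFDeriv ℝ l f (c.x + s) - iteratedFDeriv ℝ l (tensorPoly (derivs f c.x) P.p) s‖
      ≤ L * ‖s‖ ^ P.gapExp := by
    have h := norm_iteratedFDeriv_taylor_remainder_le P.β_mem.1.le hL hf.1 hf.2 c.x (P.p - l)
      (Nat.sub_le _ _) s
    rw [Nat.sub_sub_self hlp] at h
    refine h.trans (mul_le_mul_of_nonneg_left (hexp _ ?_) hL)
    rw [Nat.cast_sub hlp, Params.gapExp]
    linarith
  have h3 := norm_iteratedFDeriv_norm_rpow_le ((P.p : ℝ) + P.β) hlq hs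
  have h4 : ‖s‖ ^ ((P.p : ℝ) + P.β - l) ≤ ‖s‖ ^ P.gapExp :=
    hexp _ (by rw [Params.gapExp]; linarith)
  have hk : 0 ≤ c.σ / fracFactorial P.p P.β :=
    div_nonneg hσ (fracFactorial_pos _ P.β_mem.1).le
  have h5 : ‖(c.σ / fracFactorial P.p P.β) •
        iteratedFDeriv ℝ l (fun y : Vec n => ‖y‖ ^ ((P.p : ℝ) + P.β)) s‖
      ≤ c.σ / fracFactorial P.p P.β * normPowConst ((P.p : ℝ) + P.β) P.q * ‖s‖ ^ P.gapExp := by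
    rw [norm_smul, Real.norm_of_nonneg hk, mul_assoc]
    refine mul_le_mul_of_nonneg_left (h3.trans ?_) hk
    exact mul_le_mul_of_nonneg_left h4 (normPowConst_nonneg _ _)
  unfold modelDerivs
  rw [iteratedFDeriv_model P c.D c.σ hl1 hs]
  set a := iteratedFDeriv ℝ l (tensorPoly c.D P.p) s
  set b := iteratedFDeriv ℝ l (tensorPoly (derivs f c.x) P.p) s
  set r := (c.σ / fracFactorial P.p P.β) •
        iteratedFDeriv ℝ l (fun y : Vec n => ‖y‖ ^ ((P.p : ℝ) + P.β)) s
  have h6 : a + r - derivs f (c.x + s) l = (a - b) - (derivs f (c.x + s) l - b) + r := by abel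
  rw [h6]
  have h7 : ‖derivs f (c.x + s) l - b‖ ≤ L * ‖s‖ ^ P.gapExp := h2
  calc _ ≤ ‖a - b‖ + ‖derivs f (c.x + s) l - b‖ + ‖r‖ :=
        (norm_add_le _ _).trans (add_le_add_left (norm_sub_le _ _) _)
    _ ≤ _ := by unfold derivConst; nlinarith [h1, h7, h5]

end Model

/-! ### Elementary bounds for the algorithmic constants. -/

namespace Params

variable (P : Params)

theorem κω_pos : 0 < P.κω := P.κω_mem.1

theorem η₁_lt_one : P.η₁ < 1 := P.η₁_le.trans_lt P.η₂_lt

theorem two_mul_κω_le : 2 * P.κω ≤ P.α * P.η₁ := by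
  have := P.κω_mem.2
  linarith

theorem κω_lt : P.κω < 1 / 2 := by
  have h1 := P.two_mul_κω_le
  have h2 : P.α * P.η₁ < 1 :=
    mul_lt_one_of_nonneg_of_lt_one_left P.α_mem.1.le P.α_mem.2 P.η₁_lt_one.le
  linarith

theorem relAcc_pos {σ : ℝ} (hσ : 0 < σ) : 0 < P.relAcc σ :=
  lt_min P.κω_pos (by positivity)

theorem relAcc_le (σ : ℝ) : P.relAcc σ ≤ P.κω := min_le_left _ _

theorem relAcc_le_one (σ : ℝ) : P.relAcc σ ≤ 1 := by
  linarith [P.relAcc_le σ, P.κω_lt]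

theorem relAcc_mul_le {σ : ℝ} (hσ : 0 < σ) : P.relAcc σ * σ ≤ 1 := by
  have : P.relAcc σ ≤ 1 / σ := min_le_right _ _
  calc P.relAcc σ * σ ≤ 1 / σ * σ := by gcongr
    _ = 1 := by field_simp

theorem relAcc_anti {σ σ' : ℝ} (hσ : 0 < σ) (h : σ ≤ σ') : P.relAcc σ' ≤ P.relAcc σ := by
  unfold relAcc
  gcongr

theorem gapExp_pos : 0 < P.gapExp := by
  have h1 : (P.q : ℝ) ≤ P.p := by exact_mod_cast P.q_le_p
  have h2 := P.β_mem.1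
  unfold gapExp
  linarith

theorem degree_pos : 0 < (P.p : ℝ) + P.β := by
  have h2 := P.β_mem.1
  positivity

theorem one_le_p : 1 ≤ P.p := P.one_le_q.trans P.q_le_p

theorem rate_pos : 0 < P.rate := div_pos P.degree_pos P.gapExp_pos

/-- The factor by which the threshold of the model check is smaller than that of the check
for `f`. -/
noncomputable def xiFactor : ℝ := P.ϑ * (1 - P.κω) / (1 + P.κω) ^ 2

theorem xiFactor_pos : 0 < P.xiFactor := by
  have h1 := P.κω_lt
  have h2 := P.κω_pos
  have h3 := P.ϑ_mem.1
  unfold xiFactor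
  have : 0 < 1 - P.κω := by linarith
  positivity

theorem xiFactor_le_one : P.xiFactor ≤ 1 := by
  have h2 := P.κω_pos
  have h3 := P.ϑ_mem.1
  have h4 := P.ϑ_mem.2
  have h5 := P.κω_lt
  unfold xiFactor
  rw [div_le_one (by positivity)]
  nlinarith

end Params

/-! ### Optimality measures and the meaning of the VERIFY flags. -/

section Measures

variable {n : ℕ} {F : Set (Vec n)} {D D' : ∀ j, Tensor n j} {r : ℕ} {y : Vec n} {δ : ℝ}

theorem zero_mem_feasible (hy : y ∈ F) (hδ : 0 ≤ δ) : (0 : Vec n) ∈ feasible F y δ :=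
  ⟨by rwa [add_zero], by rwa [norm_zero]⟩

theorem isCompact_feasible (hF : IsClosed F) (y : Vec n) (δ : ℝ) :
    IsCompact (feasible F y δ) := by
  have h1 : feasible F y δ = Metric.closedBall 0 δ ∩ (fun d => y + d) ⁻¹' F := by
    ext d
    simp [feasible, and_comm]
  rw [h1]
  exact (isCompact_closedBall 0 δ).inter_right (hF.preimage (by fun_prop))

theorem isGreatest_phi (hF : IsClosed F) (hy : y ∈ F) (hδ : 0 ≤ δ) :
    IsGreatest (taylorDecrease D r '' feasible F y δ) (phi F D r y δ) :=
  ((isCompact_feasible hF y δ).image (continuous_taylorDecrease D r)).isGreatest_sSup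
    (Set.Nonempty.image _ ⟨0, zero_mem_feasible hy hδ⟩)

theorem phi_nonneg (hF : IsClosed F) (hy : y ∈ F) (hδ : 0 ≤ δ) : 0 ≤ phi F D r y δ :=
  (isGreatest_phi hF hy hδ).2 ⟨0, zero_mem_feasible hy hδ, taylorDecrease_zero D r⟩

theorem phiBar_eq_phi (hF : IsClosed F) (hy : y ∈ F) (hδ : 0 ≤ δ) :
    phiBar F D r y δ = phi F D r y δ := max_eq_right (phi_nonneg hF hy hδ)

theorem phi_le (hF : IsClosed F) (hy : y ∈ F) (hδ : 0 ≤ δ) {b : ℝ}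
    (h : ∀ d ∈ feasible F y δ, taylorDecrease D r d ≤ b) : phi F D r y δ ≤ b := by
  obtain ⟨d, hd, he⟩ := (isGreatest_phi (D := D) (r := r) hF hy hδ).1
  exact he ▸ h d hd

theorem taylorDecrease_le_phi (hF : IsClosed F) (hy : y ∈ F) (hδ : 0 ≤ δ) {d : Vec n}
    (hd : d ∈ feasible F y δ) : taylorDecrease D r d ≤ phi F D r y δ :=
  (isGreatest_phi hF hy hδ).2 ⟨d, hd, rfl⟩

theorem phi_le_phi_add (hF : IsClosed F) (hy : y ∈ F) (hδ : 0 ≤ δ) {ζ : ℕ → ℝ}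
    (h : ∀ j ∈ Finset.Icc 1 r, ‖D j - D' j‖ ≤ ζ j) :
    phi F D r y δ
      ≤ phi F D' r y δ + ∑ j ∈ Finset.Icc 1 r, ζ j / (j.factorial : ℝ) * δ ^ j := by
  refine phi_le hF hy hδ fun d hd => ?_
  have h1 := (abs_le.1 (abs_taylorDecrease_sub_le h hd.2)).2
  have h2 := taylorDecrease_le_phi (D := D') (r := r) hF hy hδ hd
  linarith

end Measures

section Verify

variable {r : ℕ} {δ dT ω ξ : ℝ} {ζ : ℕ → ℝ}

theorem verify_eq_two (h : verify r δ dT ζ ω ξ = 2) :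
    0 < dT ∧ ∑ j ∈ Finset.Icc 1 r, ζ j / (j.factorial : ℝ) * δ ^ j ≤ ω * dT := by
  unfold verify at h
  split_ifs at h with h1 h2 h3
  · simp at h
  · exact h2
  · simp at h

/-- Flag 3 is returned only after the relative test of flag 2 has failed, so `ω dT` lies below the
error sum, which lies below `ξ χ`. -/
theorem verify_one_or_three (hδ : 0 ≤ δ) (hξ : 0 ≤ ξ)
    (h : verify r δ dT ζ ω ξ = 1 ∨ verify r δ dT ζ ω ξ = 3) :
    ω * dT ≤ ξ * chi r δ ∧
      ∑ j ∈ Finset.Icc 1 r, ζ j / (j.factorial : ℝ) * δ ^ j ≤ ξ * chi r δ := by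
  have hχ := chi_nonneg r hδ
  unfold verify at h
  split_ifs at h with h1 h2 h3
  · refine ⟨?_, sum_div_factorial_mul_pow_le hδ h1.2⟩
    rw [h1.1, mul_zero]
    positivity
  · simp at h
  · refine ⟨?_, h3.2⟩
    have h4 : ω * dT < ∑ j ∈ Finset.Icc 1 r, ζ j / (j.factorial : ℝ) * δ ^ j := by
      by_contra hcon
      exact h2 ⟨h3.1, not_lt.1 hcon⟩
    exact h4.le.trans h3.2
  · simp at h

theorem verify_pos (hδ : 0 ≤ δ) (hξ : 0 ≤ ξ) (hω : 0 ≤ ω) (h : 0 < verify r δ dT ζ ω ξ) :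
    ∑ j ∈ Finset.Icc 1 r, ζ j / (j.factorial : ℝ) * δ ^ j ≤ ω * dT + ξ * chi r δ := by
  have hχ : 0 ≤ ξ * chi r δ := mul_nonneg hξ (chi_nonneg r hδ)
  unfold verify at h
  split_ifs at h with h1 h2 h3
  · rw [h1.1, mul_zero, zero_add]
    exact sum_div_factorial_mul_pow_le hδ h1.2
  · linarith [h2.2]
  · have := mul_nonneg hω h3.1.le
    linarith [h3.2]
  · exact absurd h (lt_irrefl _)

/-- This makes the inner loops finite: once all accuracies are at most `ξ`, flag 1 applies to a zero
increment, and at the latest flag 3 to a positive one. -/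
theorem exists_of_verify_eq_zero (hδ : 0 ≤ δ) (hdT : 0 ≤ dT) (h : verify r δ dT ζ ω ξ = 0) :
    ∃ j ∈ Finset.Icc 1 r, ξ < ζ j := by
  by_contra hcon
  push Not at hcon
  unfold verify at h
  split_ifs at h with h1 h2 h3
  rcases hdT.eq_or_lt with h0 | h0
  · exact h1 ⟨h0.symm, hcon⟩
  · exact h3 ⟨h0, sum_div_factorial_mul_pow_le hδ hcon⟩

theorem verify_zero_increment (h : verify r δ 0 ζ ω ξ = 1 ∨ verify r δ 0 ζ ω ξ = 3) :
    ∀ j ∈ Finset.Icc 1 r, ζ j ≤ ξ := by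
  unfold verify at h
  split_ifs at h with h1 h2 h3
  · exact h1.2
  · exact absurd h2.1 (lt_irrefl _)
  · exact absurd h3.1 (lt_irrefl _)
  · simp at h

end Verify

/-! ### What termination, or its failure in Step 1, says about the exact objective. -/

section Correctness

variable (P : Params) {n : ℕ} {F : Set (Vec n)} {ε : ℝ} {f : Vec n → ℝ} {c : Config n}

theorem xi_nonneg (hε : 0 < ε) (hσ : 0 < c.σ) : 0 ≤ P.xi ε c.σ := by
  have := P.relAcc_pos hσ
  unfold Params.xi
  positivity

/-- Since `ξ = ωε/2` and `ω ≤ 1`, increment and error get half of `ε χ` each. -/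
theorem add_le_of_relAcc_mul_le (hε : 0 < ε) {σ χ dT S : ℝ} (hσ : 0 < σ) (hχ : 0 ≤ χ)
    (h1 : P.relAcc σ * dT ≤ P.xi ε σ * χ) (h2 : S ≤ P.xi ε σ * χ) : dT + S ≤ ε * χ := by
  have hω := P.relAcc_pos hσ
  have hω1 := P.relAcc_le_one σ
  unfold Params.xi at h1 h2
  have h3 : dT ≤ ε / 2 * χ := by
    refine le_of_mul_le_mul_left (h1.trans (le_of_eq ?_)) hω
    ring
  have h4 : P.relAcc σ * ε / 2 * χ ≤ 1 * ε / 2 * χ := by gcongr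
  linarith

/-- With flag 2 the exact measure is at most `(1 + ω) v`, which explains the factor `1/(1 + ω)` in
the termination test. -/
theorem phi_le_of_stop1 (hF : IsClosed F) (hε : 0 < ε) (hσ : 0 < c.σ) (hx : c.x ∈ F)
    (hδ : 0 < c.δ) (hD : ∀ j ∈ Finset.Icc 1 P.q, ‖c.D j - derivs f c.x j‖ ≤ c.acc j) {flag : ℕ}
    (h : Check1 P F ε c flag) (hf : flag = 1 ∨ flag = 3 ∨ (flag = 2 ∧ Test1 P F ε c)) :
    phi F (derivs f c.x) P.q c.x c.δ ≤ ε * chi P.q c.δ := by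
  obtain ⟨v, hv, hflag⟩ := h
  have hvphi : v = phi F c.D P.q c.x c.δ := hv.unique (isGreatest_phi hF hx hδ.le)
  have hχ := chi_nonneg P.q hδ.le
  have hle := phi_le_phi_add (D := derivs f c.x) (D' := c.D) hF hx hδ.le
    (r := P.q) (ζ := c.acc) (fun j hj => by rw [norm_sub_rev]; exact hD j hj)
  refine hle.trans ?_
  have hω := P.relAcc_pos hσ
  rw [← hvphi]
  have h13 : flag = 1 ∨ flag = 3 → v + _ ≤ ε * chi P.q c.δ := fun h => by
    rw [hflag] at h
    have h' := verify_one_or_three hδ.le (xi_nonneg P hε hσ) h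
    exact add_le_of_relAcc_mul_le P hε hσ hχ h'.1 h'.2
  rcases hf with h1 | h3 | ⟨h2, ht⟩
  · exact h13 (Or.inl h1)
  · exact h13 (Or.inr h3)
  · rw [hflag] at h2
    have h' := (verify_eq_two h2).2
    unfold Test1 at ht
    rw [phiBar_eq_phi hF hx hδ.le, ← hvphi] at ht
    calc _ ≤ v + P.relAcc c.σ * v := by linarith
      _ = (1 + P.relAcc c.σ) * v := by ring
      _ ≤ (1 + P.relAcc c.σ) * (ε / (1 + P.relAcc c.σ) * chi P.q c.δ) := by gcongr
      _ = _ := by field_simp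

/-- Flag 2 also gives the exact measure at least `(1 - ω) v`, and `(1 - ω)/(1 + ω)` is smallest at
the upper bound `κω` of `ω`. -/
theorem lt_phi_of_pass1 (hF : IsClosed F) (hε : 0 < ε) (hσ : 0 < c.σ) (hx : c.x ∈ F)
    (hδ : 0 < c.δ) (hD : ∀ j ∈ Finset.Icc 1 P.q, ‖c.D j - derivs f c.x j‖ ≤ c.acc j) {flag : ℕ}
    (h : Check1 P F ε c flag) (hf : flag = 2 ∧ ¬ Test1 P F ε c) :
    (1 - P.κω) / (1 + P.κω) * ε * chi P.q c.δ < phi F (derivs f c.x) P.q c.x c.δ := by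
  obtain ⟨v, hv, hflag⟩ := h
  have hvphi : v = phi F c.D P.q c.x c.δ := hv.unique (isGreatest_phi hF hx hδ.le)
  have hχ := chi_pos P.one_le_q hδ
  have hle := phi_le_phi_add (D := c.D) (D' := derivs f c.x) hF hx hδ.le
    (r := P.q) (ζ := c.acc) hD
  rw [← hvphi] at hle
  obtain ⟨h2, ht⟩ := hf
  rw [hflag] at h2
  have h' := (verify_eq_two h2).2
  unfold Test1 at ht
  rw [phiBar_eq_phi hF hx hδ.le, ← hvphi, not_le] at ht
  have hω := P.relAcc_pos hσ
  have hω1 := P.relAcc_le c.σ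
  have hκ := P.κω_lt
  have hκ0 := P.κω_pos
  calc (1 - P.κω) / (1 + P.κω) * ε * chi P.q c.δ
      = (1 - P.κω) * (ε / (1 + P.κω) * chi P.q c.δ) := by field_simp
    _ ≤ (1 - P.relAcc c.σ) * (ε / (1 + P.relAcc c.σ) * chi P.q c.δ) := by
        gcongr
        linarith
    _ < (1 - P.relAcc c.σ) * v := by
        have : 0 < 1 - P.relAcc c.σ := by linarith
        gcongr
    _ ≤ _ := by linarith

theorem model_zero (P : Params) (D : ∀ j, Tensor n j) (σ : ℝ) : P.model D σ 0 = 0 := by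
  unfold Params.model
  rw [taylorDecrease_zero, norm_zero, Real.zero_rpow P.degree_pos.ne']
  simp

theorem taylorDecrease_sub_of_le (D : ∀ j, Tensor n j) {q p : ℕ} (h : q ≤ p) (d : Vec n) :
    taylorDecrease D q d
      = taylorDecrease D p d + ∑ j ∈ Finset.Icc (q + 1) p, D j (fun _ => d) / (j.factorial : ℝ) := by
  unfold taylorDecrease
  have h1 : Finset.Icc 1 p = Finset.Icc 1 q ∪ Finset.Icc (q + 1) p := by
    ext; simp; omega
  have h2 : Disjoint (Finset.Icc 1 q) (Finset.Icc (q + 1) p) := by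
    rw [Finset.disjoint_left]
    intro a ha hb
    have := Finset.mem_Icc.1 ha
    have := Finset.mem_Icc.1 hb
    omega
  rw [h1, Finset.sum_union h2]
  ring

/-- If the zero step is a global minimizer of the model, the order-`q` Taylor increments are
small relative to small radii. -/
theorem exists_radius_of_global_zero (hε : 0 < ε) (hσ : 0 < c.σ)
    (hmin : ∀ s', c.x + s' ∈ F → 0 ≤ P.model c.D c.σ s') :
    ∃ δ ∈ Ioc (0 : ℝ) 1, ∀ d ∈ feasible F c.x δ,
      taylorDecrease c.D P.q d ≤ ε / 2 * chi P.q δ := by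
  set K := c.σ / fracFactorial P.p P.β with hK
  have hK0 : 0 < K := div_pos hσ (fracFactorial_pos _ P.β_mem.1)
  set N := ∑ j ∈ Finset.Icc (P.q + 1) P.p, ‖c.D j‖ with hN
  have hN0 : 0 ≤ N := Finset.sum_nonneg fun j _ => norm_nonneg _
  have hβ := P.β_mem.1
  -- All terms beyond order `q` have degree at least `1 + β`: the tensors because `j ≥ 2 ≥ 1 + β`,
  -- the regularization because `p ≥ 1`. Their sum is at most `(K + N) δ^β · δ`; this radius makes
  -- the first factor at most `ε/2`, and `δ ≤ χ_q(δ)`.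
  set δ := min 1 ((ε / (2 * (K + N))) ^ (1 / P.β)) with hδdef
  have hδ0 : 0 < δ := lt_min one_pos (by positivity)
  have hδ1 : δ ≤ 1 := min_le_left _ _
  have hδβ : (K + N) * δ ^ P.β ≤ ε / 2 := by
    have h1 : δ ^ P.β ≤ ε / (2 * (K + N)) := by
      calc δ ^ P.β ≤ ((ε / (2 * (K + N))) ^ (1 / P.β)) ^ P.β := by
            gcongr
            exact min_le_right _ _
        _ = _ := by
            rw [← Real.rpow_mul (by positivity), one_div_mul_cancel hβ.ne', Real.rpow_one]
    calc (K + N) * δ ^ P.β ≤ (K + N) * (ε / (2 * (K + N))) := by gcongr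
      _ = _ := by field_simp
  have hpow : δ ^ (1 + P.β) = δ * δ ^ P.β := by rw [Real.rpow_add hδ0, Real.rpow_one]
  refine ⟨δ, ⟨hδ0, hδ1⟩, fun d hd => ?_⟩
  rw [taylorDecrease_sub_of_le _ P.q_le_p]
  have hm := hmin d hd.1
  unfold Params.model at hm
  have h1 : ‖d‖ ^ ((P.p : ℝ) + P.β) ≤ δ ^ (1 + P.β) := by
    have hp : (1 : ℝ) ≤ P.p := by exact_mod_cast P.one_le_p
    calc ‖d‖ ^ ((P.p : ℝ) + P.β) ≤ δ ^ ((P.p : ℝ) + P.β) :=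
          Real.rpow_le_rpow (norm_nonneg _) hd.2 P.degree_pos.le
      _ ≤ _ := Real.rpow_le_rpow_of_exponent_ge hδ0 hδ1 (by linarith)
  have h2 : ∑ j ∈ Finset.Icc (P.q + 1) P.p, c.D j (fun _ => d) / (j.factorial : ℝ)
      ≤ N * δ ^ (1 + P.β) := by
    rw [hN, Finset.sum_mul]
    refine Finset.sum_le_sum fun j hj => ?_
    have hj2 : 2 ≤ j := by have := (Finset.mem_Icc.1 hj).1; have := P.one_le_q; omega
    have h3 : ‖d‖ ^ j ≤ δ ^ (1 + P.β) := by
      calc ‖d‖ ^ j ≤ δ ^ j := pow_le_pow_left₀ (norm_nonneg _) hd.2 j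
        _ = δ ^ (j : ℝ) := (Real.rpow_natCast _ _).symm
        _ ≤ _ := Real.rpow_le_rpow_of_exponent_ge hδ0 hδ1 (by
            have h4 : (2 : ℝ) ≤ j := by exact_mod_cast hj2
            have := P.β_mem.2
            linarith)
    have h5 : (1 : ℝ) ≤ j.factorial := by exact_mod_cast Nat.one_le_iff_ne_zero.2 j.factorial_ne_zero
    calc c.D j (fun _ => d) / (j.factorial : ℝ) ≤ |c.D j (fun _ => d)| / (j.factorial : ℝ) := by
          gcongr; exact le_abs_self _
      _ ≤ |c.D j (fun _ => d)| := div_le_self (abs_nonneg _) h5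
      _ ≤ ‖c.D j‖ * ‖d‖ ^ j := abs_tensor_diag_le _ _
      _ ≤ _ := by gcongr
  have h6 : δ ≤ chi P.q δ := by
    have := Finset.single_le_sum (f := fun l : ℕ => δ ^ l / (l.factorial : ℝ))
      (s := Finset.Icc 1 P.q) (fun l _ => by positivity) (Finset.mem_Icc.2 ⟨le_rfl, P.one_le_q⟩)
    simpa [chi] using this
  have h7 : K * ‖d‖ ^ ((P.p : ℝ) + P.β) ≤ K * δ ^ (1 + P.β) := by gcongr
  calc _ ≤ K * δ ^ (1 + P.β) + N * δ ^ (1 + P.β) := by linarith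
    _ = ((K + N) * δ ^ P.β) * δ := by rw [hpow]; ring
    _ ≤ ε / 2 * chi P.q δ := by gcongr

/-- For `s = 0` the flag can only be 1, so all accuracies are at most `ξ`, and a suitable small
radius works. For `s ≠ 0`, a displacement no longer than `s` has no larger regularization term, so a
global model minimizer also maximizes the Taylor increment of order `p` over the ball of radius
`‖s‖`. -/
theorem solved_of_stop2 (hF : IsClosed F) (hε : 0 < ε) (hσ : 0 < c.σ) (hx : c.x ∈ F)
    (hD : ∀ j ∈ Finset.Icc 1 P.p, ‖c.D j - derivs f c.x j‖ ≤ c.acc j) {s : Vec n}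
    (hs : GlobalStep P F ε c s) (hf : flagS P ε c s = 1 ∨ flagS P ε c s = 3) :
    (∃ δ ∈ Ioc (0 : ℝ) 1, phi F (derivs f c.x) P.q c.x δ ≤ ε * chi P.q δ) ∨
      (s ≠ 0 ∧ phi F (derivs f c.x) P.p c.x ‖s‖ ≤ ε * chi P.p ‖s‖) := by
  have hξ := xi_nonneg P hε hσ
  obtain ⟨-, -, hmin⟩ := hs
  have hrev : ∀ j ∈ Finset.Icc 1 P.p, ‖derivs f c.x j - c.D j‖ ≤ c.acc j := fun j hj => by
    rw [norm_sub_rev]; exact hD j hj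
  rcases eq_or_ne s 0 with h0 | h0
  · left
    subst h0
    unfold flagS at hf
    rw [taylorDecrease_zero] at hf
    have hacc := verify_zero_increment hf
    rw [model_zero] at hmin
    obtain ⟨δ, hδ, hδd⟩ := exists_radius_of_global_zero (F := F) P hε hσ hmin
    refine ⟨δ, hδ, ?_⟩
    have hq : Finset.Icc 1 P.q ⊆ Finset.Icc 1 P.p := Finset.Icc_subset_Icc le_rfl P.q_le_p
    have h1 := phi_le_phi_add (r := P.q) hF hx hδ.1.le fun j hj => hrev j (hq hj)
    have h2 := phi_le hF hx hδ.1.le hδd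
    have h3 := sum_div_factorial_mul_pow_le hδ.1.le fun j hj => hacc j (hq hj)
    have h4 : P.xi ε c.σ ≤ ε / 2 := by
      have := mul_le_mul_of_nonneg_right (P.relAcc_le_one c.σ) hε.le
      unfold Params.xi
      linarith
    have h5 := mul_le_mul_of_nonneg_right h4 (chi_nonneg P.q hδ.1.le)
    linarith
  · right
    refine ⟨h0, ?_⟩
    have hn := norm_nonneg s
    obtain ⟨h1, h2⟩ := verify_one_or_three hn hξ hf
    refine (phi_le_phi_add hF hx hn hrev).trans ?_
    have h3 : phi F c.D P.p c.x ‖s‖ ≤ taylorDecrease c.D P.p s := by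
      refine phi_le hF hx hn fun d hd => ?_
      have hm := hmin d hd.1
      unfold Params.model at hm
      have hk : 0 ≤ c.σ / fracFactorial P.p P.β := (div_pos hσ (fracFactorial_pos _ P.β_mem.1)).le
      have h4 : ‖d‖ ^ ((P.p : ℝ) + P.β) ≤ ‖s‖ ^ ((P.p : ℝ) + P.β) :=
        Real.rpow_le_rpow (norm_nonneg _) hd.2 P.degree_pos.le
      have := mul_le_mul_of_nonneg_left h4 hk
      linarith
    have := add_le_of_relAcc_mul_le P hε hσ (chi_nonneg P.p hn) h1 h2
    linarith

end Correctness

/-! ### Consequences of an accepted accuracy check for the step. -/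

section StepQuality

variable (P : Params) {n : ℕ} (F : Set (Vec n)) (ε L : ℝ) (f : Vec n → ℝ)

/-- The properties of a step that has passed the accuracy checks with sufficiently accurate
derivatives. -/
structure GoodStep (c : Config n) (s : Vec n) (δ' : ℝ) : Prop where
  mem : c.x + s ∈ F
  ne : s ≠ 0
  decrease : c.σ / fracFactorial P.p P.β * ‖s‖ ^ ((P.p : ℝ) + P.β) ≤ taylorDecrease c.D P.p s
  radius : δ' ∈ Ioc (0 : ℝ) 1
  accurate : |taylorDecrease c.D P.p s - taylorDecrease (derivs f c.x) P.p s|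
    ≤ P.relAcc c.σ * taylorDecrease c.D P.p s
  optimal : LongStep P ε s ∨ phi F (derivs f (c.x + s)) P.q (c.x + s) δ'
    ≤ ((derivConst P L c.σ + 2 * P.θ / fracFactorial (P.p - P.q) P.β) * ‖s‖ ^ P.gapExp
        + P.xiModel ε c.σ) * chi P.q δ'

variable {P F ε L f}

theorem norm_le_one_of_not_longStep (hε : ε ∈ Ioo (0 : ℝ) 1) {s : Vec n}
    (h : ¬ LongStep P ε s) : ‖s‖ ≤ 1 := by
  unfold LongStep at h
  have h1 : ε ^ (1 / P.gapExp) ≤ 1 :=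
    Real.rpow_le_one hε.1.le hε.2.le (by have := P.gapExp_pos; positivity)
  have h2 : 0 ≤ ε ^ (1 / P.gapExp) := Real.rpow_nonneg hε.1.le _
  have := mul_le_one₀ P.μ_mem.2 h2 h1
  linarith [not_le.1 h]

/-- A long step needs no optimality bound. For a short one `‖s‖ ≤ 1`, so the measure of `f` at `x +
s` is that of the model up to the derivative errors of `norm_modelDerivs_sub_le`, whose inexactness
part is controlled by the model check. -/
theorem goodStep_of_candidate (hF : IsClosed F) (hε : ε ∈ Ioo (0 : ℝ) 1) (hL : 0 ≤ L)
    (hf : HolderSmooth P.p P.β L f) {c : Config n} (hσ : 0 < c.σ) (hx : c.x ∈ F)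
    (hacc : ∀ j ∈ Finset.Icc 1 P.q, ∀ l ∈ Finset.Icc j P.p, c.acc l ≤ c.acc j)
    (hD : ∀ j ∈ Finset.Icc 1 P.p, ‖c.D j - derivs f c.x j‖ ≤ c.acc j)
    {s : Vec n} {δ' v : ℝ} (hc : Candidate P F ε c s δ' v)
    (hflag : LongStep P ε s ∨ 0 < flagD P ε c δ' v) : GoodStep P F ε L f c s δ' := by
  obtain ⟨hS, hc⟩ := hc
  obtain ⟨hdT, hsum⟩ := verify_eq_two hS
  have hs : s ≠ 0 := by
    rintro rfl
    rw [taylorDecrease_zero] at hdT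
    exact lt_irrefl _ hdT
  have hmem : c.x + s ∈ F := by
    rcases hc with ⟨h, -⟩ | ⟨h, -⟩
    · exact h.2.1
    · exact h.2.1
  have hm : P.model c.D c.σ s ≤ 0 := by
    rcases hc with ⟨h, -⟩ | ⟨h, -⟩
    · exact (h.2.2.1.trans_eq (model_zero P _ _)).le
    · exact (h.2.2 0 (by rwa [add_zero])).trans_eq (model_zero P _ _)
  have hδ' : δ' ∈ Ioc (0 : ℝ) 1 := by
    rcases hc with ⟨h, -⟩ | ⟨-, h, -⟩
    · exact h.2.2.2.1
    · exact h
  have htest : StepTest P F ε c s δ' := by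
    rcases hc with ⟨h, -⟩ | ⟨-, -, h, -⟩
    · exact h.2.2.2.2
    · exact h
  refine ⟨hmem, hs, ?_, hδ', ?_, ?_⟩
  · unfold Params.model at hm
    linarith
  · exact (abs_taylorDecrease_sub_le hD le_rfl).trans hsum
  · by_cases hlong : LongStep P ε s
    · exact Or.inl hlong
    right
    have hflag := hflag.resolve_left hlong
    have htest := htest.resolve_left hlong
    have hs1 := norm_le_one_of_not_longStep hε hlong
    have hω := P.relAcc_pos hσ
    have hξ : 0 ≤ P.xiModel ε c.σ := by
      have h1 := P.xiFactor_pos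
      unfold Params.xiFactor at h1
      have h2 := hε.1
      unfold Params.xiModel
      positivity
    have hver := verify_pos hδ'.1.le hξ hω.le hflag
    set X := ‖s‖ ^ P.gapExp with hX
    set S := ∑ j ∈ Finset.Icc 1 P.q, 3 * c.acc j / (j.factorial : ℝ) * δ' ^ j with hSdef
    set G := fracFactorial (P.p - P.q) P.β with hG
    have hG0 : 0 < G := fracFactorial_pos _ P.β_mem.1
    have hX0 : 0 ≤ X := Real.rpow_nonneg (norm_nonneg _) _
    have hχ := chi_nonneg P.q hδ'.1.le
    have hθ := P.θ_pos
    rw [phiBar_eq_phi hF hmem hδ'.1.le] at htest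
    have hB : 0 ≤ P.θ * X / G * chi P.q δ' := by positivity
    have hvB : v ≤ P.θ * X / G * chi P.q δ' := by
      rcases hc with ⟨-, h⟩ | ⟨-, -, -, h⟩
      · rw [h.unique (isGreatest_phi hF hmem hδ'.1.le)]
        exact htest
      · rw [h]; exact hB
    -- The check allows an error `ω v`, again bounded by the step test; with the model measure
    -- itself this yields the coefficient `2θ`.
    have hωv : P.relAcc c.σ * v ≤ P.θ * X / G * chi P.q δ' := by
      calc P.relAcc c.σ * v ≤ P.relAcc c.σ * (P.θ * X / G * chi P.q δ') := by gcongr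
        _ ≤ _ := mul_le_of_le_one_left hB (P.relAcc_le_one _)
    have hphi := phi_le_phi_add (D := derivs f (c.x + s)) (D' := modelDerivs P c s) hF hmem
      hδ'.1.le (r := P.q) (ζ := fun l => 3 * c.acc l + derivConst P L c.σ * X)
      (fun l hl => by
        rw [norm_sub_rev]
        exact norm_modelDerivs_sub_le P hL hf hσ.le hacc hD hs hs1 hl)
    have hsplit : ∑ j ∈ Finset.Icc 1 P.q,
        (3 * c.acc j + derivConst P L c.σ * X) / (j.factorial : ℝ) * δ' ^ j
          = S + derivConst P L c.σ * X * chi P.q δ' := by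
      rw [hSdef, chi, Finset.mul_sum, ← Finset.sum_add_distrib]
      refine Finset.sum_congr rfl fun j _ => ?_
      ring
    rw [hsplit] at hphi
    calc _ ≤ _ := hphi
      _ ≤ P.θ * X / G * chi P.q δ' + (P.θ * X / G * chi P.q δ' + P.xiModel ε c.σ * chi P.q δ'
            + derivConst P L c.σ * X * chi P.q δ') := by linarith
      _ = _ := by ring

theorem GoodStep.increment_pos {c : Config n} {s : Vec n} {δ' : ℝ} (hσ : 0 < c.σ)
    (h : GoodStep P F ε L f c s δ') : 0 < taylorDecrease c.D P.p s := by
  refine lt_of_lt_of_le ?_ h.decrease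
  have := fracFactorial_pos P.p P.β_mem.1
  have := Real.rpow_pos_of_pos (norm_pos_iff.2 h.ne) ((P.p : ℝ) + P.β)
  positivity

/-- The errors of the two function values cost `2ωT ≤ α η₁ T` of the decrease `η₁ T`, where `T` is
the predicted increment. -/
theorem GoodStep.sufficient_decrease {c : Config n} {s : Vec n} {δ' f0 fp : ℝ} (hσ : 0 < c.σ)
    (h : GoodStep P F ε L f c s δ') (hσm : P.σmin ≤ c.σ)
    (h0 : |f0 - f c.x| ≤ fAcc P c s) (hp : |fp - f (c.x + s)| ≤ fAcc P c s)
    (hρ : P.η₁ ≤ (f0 - fp) / taylorDecrease c.D P.p s) :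
    f (c.x + s) + (1 - P.α) * P.η₁ * P.σmin / fracFactorial P.p P.β * ‖s‖ ^ ((P.p : ℝ) + P.β)
      ≤ f c.x := by
  have hdT := h.increment_pos hσ
  have hdec := h.decrease
  unfold fAcc at h0 hp
  rw [abs_of_pos hdT] at h0 hp
  set T := taylorDecrease c.D P.p s
  rw [le_div_iff₀ hdT] at hρ
  have h1 := (abs_le.1 h0).2
  have h2 := (abs_le.1 hp).1
  have hω : 2 * P.relAcc c.σ * T ≤ P.α * P.η₁ * T := by
    have := P.relAcc_le c.σ
    have := P.two_mul_κω_le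
    exact mul_le_mul_of_nonneg_right (by linarith) hdT.le
  have hff := fracFactorial_pos P.p P.β_mem.1
  have hN : 0 ≤ ‖s‖ ^ ((P.p : ℝ) + P.β) := Real.rpow_nonneg (norm_nonneg _) _
  have h3 : P.σmin / fracFactorial P.p P.β * ‖s‖ ^ ((P.p : ℝ) + P.β) ≤ T := by
    refine le_trans ?_ hdec
    gcongr
  have h4 : 0 ≤ (1 - P.α) * P.η₁ :=
    mul_nonneg (by linarith [P.α_mem.2]) P.η₁_pos.le
  have h5 := mul_le_mul_of_nonneg_left h3 h4
  have h6 : (1 - P.α) * P.η₁ * P.σmin / fracFactorial P.p P.β * ‖s‖ ^ ((P.p : ℝ) + P.β)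
      = (1 - P.α) * P.η₁ * (P.σmin / fracFactorial P.p P.β * ‖s‖ ^ ((P.p : ℝ) + P.β)) := by ring
  rw [h6]
  nlinarith

/-- A regularization parameter above which every step is very successful. -/
noncomputable def sigmaBar (P : Params) (L : ℝ) : ℝ :=
  (3 + L * fracFactorial P.p P.β) / (1 - P.η₂)

/-- The actual decrease differs from `T` by at most `3ωT + L‖s‖^{p+β}`: two function values, the
inexact increment, and the Taylor remainder. As `ωσ ≤ 1` and `σ‖s‖^{p+β} ≤ (p+β)! T`, this is at
most `(3 + L (p+β)!) T/σ`, hence at most `(1 - η₂) T` from `sigmaBar` on. -/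
theorem GoodStep.very_successful {c : Config n} {s : Vec n} {δ' f0 fp : ℝ} (hσ : 0 < c.σ)
    (hL : 0 ≤ L) (hf : HolderSmooth P.p P.β L f)
    (h : GoodStep P F ε L f c s δ') (hσm : sigmaBar P L ≤ c.σ)
    (h0 : |f0 - f c.x| ≤ fAcc P c s) (hp : |fp - f (c.x + s)| ≤ fAcc P c s) :
    P.η₂ ≤ (f0 - fp) / taylorDecrease c.D P.p s := by
  have hdT := h.increment_pos hσ
  have hdec := h.decrease
  have hacc := h.accurate
  have hrem := abs_taylor_remainder_le P.β_mem.1.le hL hf c.x s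
  unfold fAcc at h0 hp
  rw [abs_of_pos hdT] at h0 hp
  set T := taylorDecrease c.D P.p s
  set T' := taylorDecrease (derivs f c.x) P.p s
  set N := ‖s‖ ^ ((P.p : ℝ) + P.β)
  have hff := fracFactorial_pos P.p P.β_mem.1
  have hη : 0 < 1 - P.η₂ := by linarith [P.η₂_lt]
  rw [le_div_iff₀ hdT]
  have h1 := (abs_le.1 h0).1
  have h2 := (abs_le.1 hp).2
  have h3 := (abs_le.1 hrem).1
  have h4 := (abs_le.1 hacc).2
  have h5 : L * N * c.σ ≤ L * fracFactorial P.p P.β * T := by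
    have := mul_le_mul_of_nonneg_left hdec (mul_nonneg hL hff.le)
    calc L * N * c.σ = L * fracFactorial P.p P.β * (c.σ / fracFactorial P.p P.β * N) := by
          field_simp
      _ ≤ _ := this
  have h6 := P.relAcc_mul_le hσ
  have h7 : (3 + L * fracFactorial P.p P.β) ≤ c.σ * (1 - P.η₂) := by
    unfold sigmaBar at hσm
    rwa [div_le_iff₀ hη] at hσm
  have h8 : c.σ * (3 * P.relAcc c.σ * T + L * N) ≤ c.σ * ((1 - P.η₂) * T) := by
    have h9 : c.σ * (3 * P.relAcc c.σ * T) ≤ 3 * T := by nlinarith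
    have h10 := mul_le_mul_of_nonneg_right h7 hdT.le
    linarith
  have h11 := le_of_mul_le_mul_left h8 hσ
  linarith

end StepQuality

/-! ### Complexity constants, iteration counting and accuracy reductions. -/

section Constants

variable (P : Params) (L : ℝ)

/-- An upper bound for the regularization parameters. -/
noncomputable def sigmaMax : ℝ := max P.σ₀ (P.γ₃ * sigmaBar P L)

/-- The factor of `‖s‖^{p-q+β}` in the bound of the optimality measure after a short step. -/
noncomputable def optConst : ℝ :=
  derivConst P L (sigmaMax P L) + 2 * P.θ / fracFactorial (P.p - P.q) P.β

/-- The ratio of the optimality threshold to `ε`. -/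
noncomputable def optRatio : ℝ := (1 - P.κω) / (1 + P.κω)

/-- The factor of `ε^{1/(p-q+β)}` in the lower bound of the step length. -/
noncomputable def stepConst : ℝ :=
  min P.μ ((optRatio P / (2 * optConst P L)) ^ (1 / P.gapExp))

/-- The factor of `‖s‖^{p+β}` in the decrease of the objective in a successful iteration. -/
noncomputable def decFactor : ℝ := (1 - P.α) * P.η₁ * P.σmin / fracFactorial P.p P.β

/-- The factor of `ε^{(p+β)/(p-q+β)}` in the decrease of the objective. -/
noncomputable def decConst : ℝ := decFactor P * stepConst P L ^ ((P.p : ℝ) + P.β)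

variable {L}

theorem σ₀_pos : 0 < P.σ₀ := P.σmin_mem.1.trans_le P.σmin_mem.2

theorem γ₃_pos : 0 < P.γ₃ := zero_lt_one.trans (P.one_lt_γ₂.trans P.γ₂_lt)

theorem σ₀_le_sigmaMax : P.σ₀ ≤ sigmaMax P L := le_max_left _ _

theorem sigmaMax_pos : 0 < sigmaMax P L := (σ₀_pos P).trans_le (σ₀_le_sigmaMax P)

theorem derivConst_nonneg (hL : 0 ≤ L) {σ : ℝ} (hσ : 0 ≤ σ) : 0 ≤ derivConst P L σ := by
  have := fracFactorial_pos P.p P.β_mem.1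
  have := normPowConst_nonneg ((P.p : ℝ) + P.β) P.q
  unfold derivConst
  positivity

theorem derivConst_mono {σ σ' : ℝ} (h : σ ≤ σ') : derivConst P L σ ≤ derivConst P L σ' := by
  have := fracFactorial_pos P.p P.β_mem.1
  have := normPowConst_nonneg ((P.p : ℝ) + P.β) P.q
  unfold derivConst
  gcongr

theorem optConst_pos (hL : 0 ≤ L) : 0 < optConst P L := by
  have h1 := derivConst_nonneg P hL (sigmaMax_pos P (L := L)).le
  have h2 := fracFactorial_pos (P.p - P.q) P.β_mem.1
  have h3 := P.θ_pos
  unfold optConst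
  positivity

theorem optRatio_pos : 0 < optRatio P := by
  have h1 := P.κω_lt
  have h2 := P.κω_pos
  have : 0 < 1 - P.κω := by linarith
  unfold optRatio
  positivity

theorem stepConst_pos (hL : 0 ≤ L) : 0 < stepConst P L :=
  lt_min P.μ_mem.1 (Real.rpow_pos_of_pos
    (div_pos (optRatio_pos P) (mul_pos two_pos (optConst_pos P hL))) _)

theorem decFactor_pos : 0 < decFactor P := by
  have h1 : 0 < 1 - P.α := by linarith [P.α_mem.2]
  have h2 := P.η₁_pos
  have h3 := P.σmin_mem.1
  have h4 := fracFactorial_pos P.p P.β_mem.1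
  unfold decFactor
  positivity

theorem decConst_pos (hL : 0 ≤ L) : 0 < decConst P L :=
  mul_pos (decFactor_pos P) (Real.rpow_pos_of_pos (stepConst_pos P hL) _)

/-- The absolute slack of the model check uses up at most half of the optimality threshold; the
other half must come from the step length. -/
theorem xiModel_le {ε σ : ℝ} (hε : 0 < ε) (hσ : 0 < σ) :
    P.xiModel ε σ ≤ optRatio P * ε / 2 := by
  have h1 := P.relAcc_le_one σ
  have h2 := P.relAcc_pos hσ
  have h3 := optRatio_pos P
  have h4 := P.κω_pos
  have h5 := P.ϑ_mem.1
  have h6 := P.ϑ_mem.2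
  have h7 : P.ϑ * (1 - P.κω) / (1 + P.κω) ^ 2 = P.ϑ * optRatio P * (1 / (1 + P.κω)) := by
    unfold optRatio
    field_simp
  have h8 : 1 / (1 + P.κω) ≤ 1 := by
    rw [div_le_one (by positivity)]
    linarith
  unfold Params.xiModel
  rw [h7]
  calc P.ϑ * optRatio P * (1 / (1 + P.κω)) * (P.relAcc σ * ε / 2)
      ≤ 1 * optRatio P * 1 * (1 * ε / 2) := by gcongr
    _ = _ := by ring

/-- If the new point is not nearly optimal for the new radius, the step cannot be too short: either
it is long by definition, or `optConst ‖s‖^{p-q+β}` is at least half of `optRatio ε`. The power `p +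
β` turns this into the rate. -/
theorem decConst_le_of_goodStep {n : ℕ} {F : Set (Vec n)} {f : Vec n → ℝ} {ε : ℝ}
    (hε : ε ∈ Ioo (0 : ℝ) 1) (hL : 0 ≤ L) {c : Config n} (hσ : 0 < c.σ)
    (hσm : c.σ ≤ sigmaMax P L) {s : Vec n} {δ' : ℝ} (h : GoodStep P F ε L f c s δ')
    (hφ : optRatio P * ε * chi P.q δ' < phi F (derivs f (c.x + s)) P.q (c.x + s) δ') :
    decConst P L * ε ^ P.rate ≤ decFactor P * ‖s‖ ^ ((P.p : ℝ) + P.β) := by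
  have hg := P.gapExp_pos
  have hs0 := stepConst_pos P hL
  have hε0 := hε.1
  have hstep : stepConst P L * ε ^ (1 / P.gapExp) ≤ ‖s‖ := by
    rcases h.optimal with hl | ho
    · refine le_trans ?_ hl
      have : 0 ≤ ε ^ (1 / P.gapExp) := by positivity
      gcongr
      exact min_le_left _ _
    · have hχ := chi_pos P.one_le_q h.radius.1
      have h1 := lt_of_mul_lt_mul_right (hφ.trans_le ho) hχ.le
      have h2 := xiModel_le P hε0 hσ
      have hX : 0 ≤ ‖s‖ ^ P.gapExp := Real.rpow_nonneg (norm_nonneg _) _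
      have h3 : derivConst P L c.σ + 2 * P.θ / fracFactorial (P.p - P.q) P.β ≤ optConst P L :=
        add_le_add_left (derivConst_mono P hσm) _
      have h4 := mul_le_mul_of_nonneg_right h3 hX
      have hK := optConst_pos P hL
      have hr := optRatio_pos P
      have h5 : optRatio P / (2 * optConst P L) * ε ≤ ‖s‖ ^ P.gapExp := by
        rw [div_mul_eq_mul_div, div_le_iff₀ (by positivity)]
        linarith
      calc stepConst P L * ε ^ (1 / P.gapExp)
          ≤ (optRatio P / (2 * optConst P L)) ^ (1 / P.gapExp) * ε ^ (1 / P.gapExp) := by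
            gcongr
            exact min_le_right _ _
        _ = (optRatio P / (2 * optConst P L) * ε) ^ (1 / P.gapExp) :=
            (Real.mul_rpow (by positivity) hε0.le).symm
        _ ≤ (‖s‖ ^ P.gapExp) ^ (1 / P.gapExp) := by gcongr
        _ = ‖s‖ := by
            rw [← Real.rpow_mul (norm_nonneg _), mul_one_div_cancel hg.ne', Real.rpow_one]
  have hd := P.degree_pos
  have h6 : stepConst P L ^ ((P.p : ℝ) + P.β) * ε ^ P.rate ≤ ‖s‖ ^ ((P.p : ℝ) + P.β) := by
    calc stepConst P L ^ ((P.p : ℝ) + P.β) * ε ^ P.rate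
        = (stepConst P L * ε ^ (1 / P.gapExp)) ^ ((P.p : ℝ) + P.β) := by
          rw [Real.mul_rpow hs0.le (by positivity), ← Real.rpow_mul hε0.le, Params.rate]
          congr 2
          ring
      _ ≤ _ := by gcongr
  unfold decConst
  rw [mul_assoc]
  exact mul_le_mul_of_nonneg_left h6 (decFactor_pos P).le

/-- `σ` can grow only below `sigmaBar`, and then by a factor of at most `γ₃`, so it never passes
`sigmaMax`. -/
theorem SigmaUpdate.bounds {ρ σ σ' : ℝ} (h : SigmaUpdate P ρ σ σ') (hσ : 0 < σ)
    (hmin : P.σmin ≤ σ) (hmax : σ ≤ sigmaMax P L) (hvs : sigmaBar P L ≤ σ → P.η₂ ≤ ρ) :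
    P.σmin ≤ σ' ∧ σ' ≤ sigmaMax P L ∧ (P.η₁ ≤ ρ → P.γ₁ * σ ≤ σ') ∧
      (ρ < P.η₁ → P.γ₂ * σ ≤ σ') := by
  obtain ⟨h1, h2, h3⟩ := h
  have hγ₂ := P.one_lt_γ₂
  have hγ₁ : P.γ₁ * σ ≤ σ := mul_le_of_le_one_left hσ.le P.γ₁_mem.2.le
  have hγ₂σ : σ ≤ P.γ₂ * σ := le_mul_of_one_le_left hσ.le hγ₂.le
  have hγ₃ : P.γ₂ * σ ≤ P.γ₃ * σ := mul_le_mul_of_nonneg_right P.γ₂_lt.le hσ.le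
  by_cases c1 : P.η₂ ≤ ρ
  · obtain ⟨h4, h5⟩ := h1 c1
    refine ⟨(le_max_left _ _).trans h4, h5.trans hmax, fun _ => (le_max_right _ _).trans h4, ?_⟩
    intro h6
    linarith [P.η₁_le]
  · have hσb : σ ≤ sigmaBar P L := by
      by_contra hcon
      exact c1 (hvs (not_le.1 hcon).le)
    have hup : P.γ₃ * σ ≤ sigmaMax P L :=
      (mul_le_mul_of_nonneg_left hσb (γ₃_pos P).le).trans (le_max_right _ _)
    rcases le_or_gt P.η₁ ρ with c2 | c2
    · obtain ⟨h4, h5⟩ := h2 c2 (not_le.1 c1)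
      exact ⟨hmin.trans h4, h5.trans (hγ₃.trans hup), fun _ => hγ₁.trans h4, fun h6 => by linarith⟩
    · obtain ⟨h4, h5⟩ := h3 c2
      exact ⟨by linarith, h5.trans hup, fun h6 => by linarith, fun _ => h4⟩

/-- The constant of the bound of the number of iterations. -/
noncomputable def iterConst (P : Params) (L gap : ℝ) : ℝ :=
  (|gap| / decConst P L + 1) * (1 + Real.log P.γ₁⁻¹ / Real.log P.γ₂)
    + Real.log (sigmaMax P L / P.σ₀) / Real.log P.γ₂

theorem log_γ₂_pos : 0 < Real.log P.γ₂ := Real.log_pos P.one_lt_γ₂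

theorem log_inv_γ₁_pos : 0 < Real.log P.γ₁⁻¹ :=
  Real.log_pos ((one_lt_inv₀ P.γ₁_mem.1).2 P.γ₁_mem.2)

theorem log_sigmaMax_div_nonneg : 0 ≤ Real.log (sigmaMax P L / P.σ₀) :=
  Real.log_nonneg ((one_le_div (σ₀_pos P)).2 (σ₀_le_sigmaMax P))

theorem iterConst_nonneg (hL : 0 ≤ L) (gap : ℝ) : 0 ≤ iterConst P L gap := by
  have h1 := log_γ₂_pos P
  have h2 := log_inv_γ₁_pos P
  have h3 := log_sigmaMax_div_nonneg P (L := L)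
  have h4 := decConst_pos P hL
  unfold iterConst
  positivity

theorem one_le_rpow_neg_rate {ε : ℝ} (hε : ε ∈ Ioo (0 : ℝ) 1) : 1 ≤ ε ^ (-P.rate) :=
  Real.one_le_rpow_of_pos_of_le_one_of_nonpos hε.1 hε.2.le (by linarith [P.rate_pos])

/-- The total decrease bounds `nS`; taking logarithms in `σ₀ γ₁^nS γ₂^nU ≤ sigmaMax` bounds `nU`
linearly in `nS`. Additive constants are absorbed because `ε ^ (-rate) ≥ 1`. -/
theorem iter_le_of_counts (hL : 0 ≤ L) {gap ε : ℝ} (hε : ε ∈ Ioo (0 : ℝ) 1) {nS nU : ℕ} {σ : ℝ}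
    (hσ : σ ≤ sigmaMax P L) (h1 : P.σ₀ * P.γ₁ ^ nS * P.γ₂ ^ nU ≤ σ)
    (h2 : ((nS : ℝ) - 1) * (decConst P L * ε ^ P.rate) ≤ gap) :
    ((nS + nU : ℕ) : ℝ) ≤ iterConst P L gap * ε ^ (-P.rate) := by
  have hR := one_le_rpow_neg_rate P hε
  have hε0 := hε.1
  have hd := decConst_pos P hL
  have hl2 := log_γ₂_pos P
  have hl1 := log_inv_γ₁_pos P
  have hl3 := log_sigmaMax_div_nonneg P (L := L)
  have hσ0 := σ₀_pos P
  have hγ1 := P.γ₁_mem.1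
  have hγ2 : 0 < P.γ₂ := zero_lt_one.trans P.one_lt_γ₂
  have hcan : ε ^ P.rate * ε ^ (-P.rate) = 1 := by
    rw [← Real.rpow_add hε0, add_neg_cancel, Real.rpow_zero]
  set R := ε ^ (-P.rate)
  have hS : (nS : ℝ) ≤ (|gap| / decConst P L + 1) * R := by
    have h3 : ((nS : ℝ) - 1) * decConst P L ≤ |gap| * R := by
      calc ((nS : ℝ) - 1) * decConst P L
          = ((nS : ℝ) - 1) * (decConst P L * ε ^ P.rate) * R := by
            rw [mul_assoc, mul_assoc, hcan, mul_one]
        _ ≤ |gap| * R := by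
            gcongr
            exact h2.trans (le_abs_self gap)
    have h4 : (nS : ℝ) - 1 ≤ |gap| / decConst P L * R := by
      rw [div_mul_eq_mul_div, le_div_iff₀ hd]
      exact h3
    linarith
  have hU : (nU : ℝ) * Real.log P.γ₂
      ≤ Real.log (sigmaMax P L / P.σ₀) + nS * Real.log P.γ₁⁻¹ := by
    have h5 : Real.log (P.σ₀ * P.γ₁ ^ nS * P.γ₂ ^ nU) ≤ Real.log (sigmaMax P L) :=
      Real.log_le_log (by positivity) (h1.trans hσ)
    rw [Real.log_mul (by positivity) (by positivity), Real.log_mul (by positivity) (by positivity),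
      Real.log_pow, Real.log_pow] at h5
    rw [Real.log_div (sigmaMax_pos P).ne' hσ0.ne', Real.log_inv]
    linarith
  have hU' : (nU : ℝ) ≤ Real.log (sigmaMax P L / P.σ₀) / Real.log P.γ₂
      + nS * (Real.log P.γ₁⁻¹ / Real.log P.γ₂) := by
    rw [← mul_div_assoc, ← add_div, le_div_iff₀ hl2]
    exact hU
  push_cast
  unfold iterConst
  have h6 : Real.log (sigmaMax P L / P.σ₀) / Real.log P.γ₂
      ≤ Real.log (sigmaMax P L / P.σ₀) / Real.log P.γ₂ * R :=
    le_mul_of_one_le_right (by positivity) hR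
  have h7 : 0 ≤ 1 + Real.log P.γ₁⁻¹ / Real.log P.γ₂ := by positivity
  have h8 := mul_le_mul_of_nonneg_right hS h7
  calc (nS : ℝ) + nU ≤ nS * (1 + Real.log P.γ₁⁻¹ / Real.log P.γ₂)
        + Real.log (sigmaMax P L / P.σ₀) / Real.log P.γ₂ * R := by linarith
    _ ≤ _ := by linarith

/-- The ratio to `ε` of a lower bound of the accuracies that can be reduced. -/
noncomputable def accConst (P : Params) (L : ℝ) : ℝ :=
  P.relAcc (sigmaMax P L) * P.xiFactor / 6

theorem accConst_pos : 0 < accConst P L := by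
  have h1 := P.relAcc_pos (sigmaMax_pos P (L := L))
  have h2 := P.xiFactor_pos
  unfold accConst
  positivity

theorem accConst_mul_le_xi {ε σ : ℝ} (hε : 0 < ε) (hσ : 0 < σ) (h : σ ≤ sigmaMax P L) :
    accConst P L * ε ≤ P.xi ε σ := by
  have h0 := P.relAcc_pos hσ
  have h1 := P.relAcc_anti hσ h
  have h2 := P.relAcc_pos (sigmaMax_pos P (L := L))
  have h3 := P.xiFactor_pos
  have h4 := P.xiFactor_le_one
  unfold accConst Params.xi
  calc P.relAcc (sigmaMax P L) * P.xiFactor / 6 * ε ≤ P.relAcc σ * 1 / 6 * ε := by gcongr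
    _ ≤ _ := by nlinarith [mul_pos h0 hε]

/-- The 6 in `accConst` is the 2 of `ξ = ωε/2` times the 3 of the model check; `ω` is smallest at
`sigmaMax`. -/
theorem accConst_mul_le_xiModel {ε σ : ℝ} (hε : 0 < ε) (hσ : 0 < σ) (h : σ ≤ sigmaMax P L) :
    3 * (accConst P L * ε) ≤ P.xiModel ε σ := by
  have h1 := P.relAcc_anti hσ h
  have h3 := P.xiFactor_pos
  have h5 : P.xiModel ε σ = P.xiFactor * (P.relAcc σ * ε / 2) := rfl
  rw [h5]
  unfold accConst
  calc 3 * (P.relAcc (sigmaMax P L) * P.xiFactor / 6 * ε)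
      = P.xiFactor * (P.relAcc (sigmaMax P L) * ε / 2) := by ring
    _ ≤ _ := by gcongr

/-- A bound for the number of reductions of the accuracies in one iteration. -/
noncomputable def maxRetries (P : Params) (L ε : ℝ) : ℕ :=
  ⌈Real.log (P.κε / (accConst P L * ε)) / Real.log P.γε⁻¹⌉₊

theorem log_inv_γε_pos : 0 < Real.log P.γε⁻¹ :=
  Real.log_pos ((one_lt_inv₀ P.γε_mem.1).2 P.γε_mem.2)

/-- An accuracy that has been reduced `a` times and is still above `accConst ε` forces `a` strictly
below the logarithmic bound, so one more reduction fits under its ceiling. -/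
theorem succ_le_maxRetries {ε e : ℝ} (hε : 0 < ε) {a : ℕ} (h1 : accConst P L * ε < e)
    (h2 : e ≤ P.κε * P.γε ^ a) : a + 1 ≤ maxRetries P L ε := by
  have hA := accConst_pos P (L := L)
  have hκ := P.κε_pos
  have hγ := P.γε_mem.1
  have hl := log_inv_γε_pos P
  have h3 : accConst P L * ε < P.κε * P.γε ^ a := h1.trans_le h2
  have h4 := Real.log_lt_log (by positivity) h3
  rw [Real.log_mul hκ.ne' (by positivity), Real.log_pow] at h4
  have h5 : (a : ℝ) < Real.log (P.κε / (accConst P L * ε)) / Real.log P.γε⁻¹ := by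
    rw [lt_div_iff₀ hl, Real.log_div hκ.ne' (by positivity), Real.log_inv]
    linarith
  exact Nat.succ_le_of_lt (Nat.lt_ceil.2 h5)

/-- The constant of the bound of the number of reductions of the accuracies. -/
noncomputable def retryConst (P : Params) (L : ℝ) : ℝ :=
  (|Real.log (P.κε / accConst P L)| + 1) / Real.log P.γε⁻¹ + 1

theorem retryConst_pos : 0 < retryConst P L := by
  have hl := log_inv_γε_pos P
  unfold retryConst
  positivity

theorem maxRetries_le {ε : ℝ} (hε : ε ∈ Ioo (0 : ℝ) 1) :
    (maxRetries P L ε : ℝ) ≤ retryConst P L * (1 + |Real.log ε|) := by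
  have hA := accConst_pos P (L := L)
  have hκ := P.κε_pos
  have hl := log_inv_γε_pos P
  have hε0 := hε.1
  set X := |Real.log (P.κε / accConst P L)|
  set Y := |Real.log ε|
  have hX : 0 ≤ X := abs_nonneg _
  have hY : 0 ≤ Y := abs_nonneg _
  have h1 : Real.log (P.κε / (accConst P L * ε)) ≤ X + Y := by
    rw [← div_div, Real.log_div (by positivity) hε0.ne']
    have := le_abs_self (Real.log (P.κε / accConst P L))
    have := neg_abs_le (Real.log ε)
    linarith
  have h2 : (maxRetries P L ε : ℝ) ≤ (X + Y) / Real.log P.γε⁻¹ + 1 := by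
    have h3 : maxRetries P L ε ≤ ⌈(X + Y) / Real.log P.γε⁻¹⌉₊ :=
      Nat.ceil_mono (div_le_div_of_nonneg_right h1 hl.le)
    have h4 := Nat.ceil_lt_add_one (a := (X + Y) / Real.log P.γε⁻¹) (by positivity)
    have h5 : (maxRetries P L ε : ℝ) ≤ ⌈(X + Y) / Real.log P.γε⁻¹⌉₊ := by exact_mod_cast h3
    linarith
  refine h2.trans ?_
  have h6 : X + Y ≤ (X + 1) * (1 + Y) := by nlinarith
  have h7 : (X + Y) / Real.log P.γε⁻¹ ≤ (X + 1) * (1 + Y) / Real.log P.γε⁻¹ := by gcongr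
  unfold retryConst
  rw [add_mul, div_mul_eq_mul_div]
  linarith

end Constants

/-- The stages of an iteration before the optimality test has failed. -/
def Stage.Early {n : ℕ} : Stage n → Prop
  | .start | .eval1 | .check1 => True
  | _ => False

/-- The number of transitions from the beginning of an iteration, without retries. -/
def Stage.rank {n : ℕ} : Stage n → ℕ
  | .start => 0
  | .eval1 => 1
  | .check1 => 2
  | .eval2 => 3
  | .check2 => 4
  | .evalF _ _ => 5
  | .update .. => 6
  | .stop1 | .stop2 _ => 0

/-- The number of derivative evaluation rounds since the beginning of an iteration, without
retries. -/
def Stage.rounds {n : ℕ} : Stage n → ℕ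
  | .start | .eval1 => 0
  | .check1 | .eval2 => 1
  | _ => 2

/-- The maximal number of function evaluations since the beginning of an iteration. -/
def Stage.evals {n : ℕ} : Stage n → ℕ
  | .update .. => 2
  | _ => 0

/-! ### The invariant of a run and its components. -/

section Invariants

variable (P : Params) (L : ℝ) {n : ℕ} (F : Set (Vec n)) (f : Vec n → ℝ) (x₀ : Vec n) (ε : ℝ)

/-- The approximation of the `j`-th derivative has the accuracy that was requested for it. -/
def TensorOK (c : Config n) (j : ℕ) : Prop :=
  ∀ g : ℝ, c.got j = (g : WithTop ℝ) → ‖c.D j - derivs f c.x j‖ ≤ g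

/-- The approximations before an evaluation of the derivatives of orders `1, …, r`. -/
def BeforeEval (r : ℕ) (c : Config n) : Prop :=
  ∀ j, TensorOK f c j ∨ (j ∈ Finset.Icc 1 r ∧ (c.acc j : WithTop ℝ) < c.got j)

/-- The approximations after an evaluation of the derivatives of orders `1, …, r`. -/
def AfterEval (r : ℕ) (c : Config n) : Prop :=
  (∀ j ∈ Finset.Icc 1 r, c.got j ≤ (c.acc j : WithTop ℝ)) ∧
    ∀ j, TensorOK f c j ∨
      (j ∈ c.fresh ∧ j ∈ Finset.Icc 1 r ∧ c.got j = (c.acc j : WithTop ℝ))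

/-- The properties of the data of a configuration that depend on its stage. -/
def DataInv (c : Config n) : Stage n → Prop
  | .start => ∀ j, TensorOK f c j
  | .eval1 => BeforeEval f P.q c
  | .check1 => AfterEval f P.q c
  | .eval2 => BeforeEval f P.p c
  | .check2 => AfterEval f P.p c
  | .evalF s δ' => (∀ j, TensorOK f c j) ∧ GoodStep P F ε L f c s δ'
  | .update s δ' f0 _ b => (∀ j, TensorOK f c j) ∧ GoodStep P F ε L f c s δ' ∧
      (b = false → |f0 - f c.x| ≤ fAcc P c s)
  | .stop1 | .stop2 _ => False

/-- The progress made after `iter` iterations: `nS` successful and `nU` unsuccessful ones. -/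
def CountInv (iter : ℕ) (x : Vec n) (σ δ : ℝ) (early : Prop) : Prop :=
  ∃ nS nU : ℕ, iter = nS + nU ∧ P.σ₀ * P.γ₁ ^ nS * P.γ₂ ^ nU ≤ σ ∧
    f x + ((nS : ℝ) - 1) * (decConst P L * ε ^ P.rate) ≤ f x₀ ∧
    ((early → optRatio P * ε * chi P.q δ < phi F (derivs f x) P.q x δ) →
      f x + (nS : ℝ) * (decConst P L * ε ^ P.rate) ≤ f x₀)

/-- The accuracies after `a` reductions. -/
def AccInv (a : ℕ) (acc : ℕ → ℝ) : Prop :=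
  (∀ j ∈ Finset.Icc 1 P.p, 0 < acc j ∧ acc j ≤ P.κε * P.γε ^ a) ∧
    ∀ j ∈ Finset.Icc 1 P.q, ∀ l ∈ Finset.Icc j P.p, acc l ≤ acc j

/-- The work spent until the `m`-th transition. -/
def WorkInv (m iter numF numD : ℕ) (acc : ℕ → ℝ) (st : Stage n) : Prop :=
  ∃ a ≤ maxRetries P L ε, (st = Stage.start → a = 0) ∧ (st ≠ Stage.start → AccInv P a acc) ∧
    m ≤ iter * (2 * maxRetries P L ε + 7) + 2 * a + st.rank ∧
    numD ≤ P.p * (iter * (maxRetries P L ε + 2) + a + st.rounds) ∧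
    numF ≤ 2 * iter + st.evals

/-- The invariant of a run. -/
structure RunInv (m : ℕ) (c : Config n) : Prop where
  mem : c.x ∈ F
  σmin_le : P.σmin ≤ c.σ
  le_sigmaMax : c.σ ≤ sigmaMax P L
  radius : c.δ ∈ Ioc (0 : ℝ) 1
  value : ∀ g : ℝ, c.fgot = (g : WithTop ℝ) → |c.fval - f c.x| ≤ g
  count : CountInv P L F f x₀ ε c.iter c.x c.σ c.δ c.stage.Early
  work : WorkInv P L ε m c.iter c.numF c.numD c.acc c.stage
  data : DataInv P L F f ε c c.stage

/-- A terminated configuration with the bounds of the work spent. -/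
def Finished (gap : ℝ) (c : Config n) : Prop :=
  Solved P F f ε c ∧ (c.iter : ℝ) ≤ iterConst P L gap * ε ^ (-P.rate) ∧ c.numF ≤ 2 * c.iter ∧
    c.numD ≤ P.p * ((c.iter + 1) * (maxRetries P L ε + 2))

/-- The accuracy requirements of the transition from `c` to `c'`. -/
structure LocalMeets (c c' : Config n) : Prop where
  step1 : c.stage = Stage.check1 → c'.stage ≠ Stage.eval1 →
    ∀ j ∈ Finset.Icc 1 P.q, j ∈ c.fresh → ‖c.D j - derivs f c.x j‖ ≤ c.acc j
  step2 : c.stage = Stage.check2 → c'.stage ≠ Stage.eval2 →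
    ∀ j ∈ Finset.Icc 1 P.p, j ∈ c.fresh → ‖c.D j - derivs f c.x j‖ ≤ c.acc j
  trial : ∀ s δ' f0 fp b, c.stage = Stage.update s δ' f0 fp b →
    |fp - f (c.x + s)| ≤ fAcc P c s
  iterate : ∀ s δ' f0 fp, c.stage = Stage.update s δ' f0 fp true → |f0 - f c.x| ≤ fAcc P c s

variable {P L F f x₀ ε}

theorem localMeets_of_meets {ρ : ℕ → Config n} {m : ℕ}
    (h : ∀ i, Meets P f ρ (ρ m).iter i) : LocalMeets P f (ρ m) (ρ (m + 1)) where
  step1 hc hc' j hj hfr := by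
    obtain ⟨h1, h2⟩ := Finset.mem_Icc.1 hj
    obtain ⟨i, rfl⟩ : ∃ i, j = i + 1 := ⟨j - 1, by omega⟩
    exact h (Sum.inl ⟨i, by omega⟩) m rfl hc hc' hfr
  step2 hc hc' j hj hfr := by
    obtain ⟨h1, h2⟩ := Finset.mem_Icc.1 hj
    obtain ⟨i, rfl⟩ : ∃ i, j = i + 1 := ⟨j - 1, by omega⟩
    exact h (Sum.inr (Sum.inl ⟨i, by omega⟩)) m rfl hc hc' hfr
  trial s δ' f0 fp b hc := h (Sum.inr (Sum.inr 0)) m s δ' f0 fp b rfl hc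
  iterate s δ' f0 fp hc := h (Sum.inr (Sum.inr 1)) m s δ' f0 fp rfl hc

theorem RunInv.σ_pos {m : ℕ} {c : Config n} (h : RunInv P L F f x₀ ε m c) : 0 < c.σ :=
  P.σmin_mem.1.trans_le h.σmin_le

theorem RunInv.iter_le (hL : 0 ≤ L) (hε : ε ∈ Ioo (0 : ℝ) 1) {fLow gap : ℝ}
    (hlow : ∀ x, fLow ≤ f x) (hgap : f x₀ - fLow ≤ gap) {m : ℕ} {c : Config n}
    (h : RunInv P L F f x₀ ε m c) : (c.iter : ℝ) ≤ iterConst P L gap * ε ^ (-P.rate) := by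
  obtain ⟨nS, nU, hi, hσ, hf, -⟩ := h.count
  rw [hi]
  refine iter_le_of_counts P hL hε h.le_sigmaMax hσ ?_
  have := hlow c.x
  linarith

theorem AfterEval.accurate {r : ℕ} {c : Config n} (h : AfterEval f r c)
    (hm : ∀ j ∈ Finset.Icc 1 r, j ∈ c.fresh → ‖c.D j - derivs f c.x j‖ ≤ c.acc j) :
    (∀ j, TensorOK f c j) ∧ ∀ j ∈ Finset.Icc 1 r, ‖c.D j - derivs f c.x j‖ ≤ c.acc j := by
  have hok : ∀ j, TensorOK f c j := fun j => by
    rcases h.2 j with h1 | ⟨h1, h2, h3⟩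
    · exact h1
    · intro g hg
      rw [h3] at hg
      rw [← WithTop.coe_inj.1 hg]
      exact hm j h2 h1
  refine ⟨hok, fun j hj => ?_⟩
  obtain ⟨g, hg, hle⟩ := WithTop.le_coe_iff.1 (h.1 j hj)
  exact (hok j g hg).trans hle

/-- A tensor not known to be accurate has `acc j < got j`, so it may not be reused and is evaluated
afresh. -/
theorem Evaluates.afterEval {r : ℕ} {st : Stage n} {c c' : Config n} (h : Evaluates r st c c')
    (hb : BeforeEval f r c) : AfterEval f r c' := by
  obtain ⟨S, D', got', hS, hav, hgot, hkeep, rfl⟩ := h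
  refine ⟨fun j hj => ?_, fun j => ?_⟩
  · by_cases hjS : j ∈ S
    · exact (hgot j hjS).le
    · change got' j ≤ _
      rw [(hkeep j hjS).2]
      exact hav j hj hjS
  · by_cases hjS : j ∈ S
    · exact Or.inr ⟨hjS, hS hjS, hgot j hjS⟩
    · left
      rcases hb j with h1 | ⟨h1, h2⟩
      · intro g hg
        change got' j = _ at hg
        change ‖D' j - _‖ ≤ _
        rw [(hkeep j hjS).2] at hg
        rw [(hkeep j hjS).1]
        exact h1 g hg
      · exact absurd (hav j h1 hjS) (not_le.2 h2)

/-- Accuracy is guaranteed only in the last pass. Values from a discarded pass may be wrong, but the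
reduced accuracy is strictly finer than the one requested for them, which rules out their reuse. -/
theorem AfterEval.retry {r : ℕ} {c : Config n} {st : Stage n} (h : AfterEval f r c)
    (hacc : ∀ j ∈ Finset.Icc 1 r, 0 < c.acc j) :
    BeforeEval f r { c with acc := fun j => P.γε * c.acc j, stage := st } := by
  intro j
  rcases h.2 j with h1 | ⟨-, h2, h3⟩
  · exact Or.inl h1
  · refine Or.inr ⟨h2, ?_⟩
    change ((P.γε * c.acc j : ℝ) : WithTop ℝ) < c.got j
    rw [h3]
    exact WithTop.coe_lt_coe.2 (mul_lt_of_lt_one_left (hacc j h2) P.γε_mem.2)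

theorem AccInv.reduce {a : ℕ} {acc : ℕ → ℝ} (h : AccInv P a acc) :
    AccInv P (a + 1) (fun j => P.γε * acc j) := by
  have hγ := P.γε_mem.1
  refine ⟨fun j hj => ⟨mul_pos hγ (h.1 j hj).1, ?_⟩, fun j hj l hl => ?_⟩
  · calc P.γε * acc j ≤ P.γε * (P.κε * P.γε ^ a) := by
          gcongr
          exact (h.1 j hj).2
      _ = _ := by ring
  · have := h.2 j hj l hl
    exact mul_le_mul_of_nonneg_left this hγ.le

theorem RunInv.acc {m : ℕ} {c : Config n} (h : RunInv P L F f x₀ ε m c)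
    (hst : c.stage ≠ Stage.start) : ∃ a, AccInv P a c.acc := by
  obtain ⟨a, -, -, ha, -⟩ := h.work
  exact ⟨a, ha hst⟩

/-- A retry goes back one rank with one transition, so each reduction is charged two transitions and
one round of evaluations. -/
theorem WorkInv.reduce {m iter numF numD : ℕ} {acc : ℕ → ℝ} {st st' : Stage n} (hε : 0 < ε)
    (h : WorkInv P L ε m iter numF numD acc st) (hst : st ≠ Stage.start)
    (hst' : st' ≠ Stage.start) (hrank : st.rank = st'.rank + 1) (hrounds : st.rounds = st'.rounds + 1)
    (hevals : st.evals = st'.evals)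
    (hj : ∃ j ∈ Finset.Icc 1 P.p, accConst P L * ε < acc j) :
    WorkInv P L ε (m + 1) iter numF numD (fun j => P.γε * acc j) st' := by
  obtain ⟨a, ha, -, hacc, hm, hD, hF⟩ := h
  obtain ⟨j, hj1, hj2⟩ := hj
  refine ⟨a + 1, succ_le_maxRetries P hε hj2 ((hacc hst).1 j hj1).2,
    fun h => absurd h hst', fun _ => (hacc hst).reduce, by omega, ?_, by omega⟩
  rw [hrounds] at hD
  refine hD.trans (le_of_eq ?_)
  ring

theorem WorkInv.advance {m iter numF numD : ℕ} {acc : ℕ → ℝ} {st st' : Stage n}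
    (h : WorkInv P L ε m iter numF numD acc st) (hst : st ≠ Stage.start)
    (hrank : st.rank + 1 ≤ st'.rank) {k : ℕ} (hk : k ≤ P.p * (st'.rounds - st.rounds))
    (hrounds : st.rounds ≤ st'.rounds) {i : ℕ} (hi : i + st.evals ≤ st'.evals) :
    WorkInv P L ε (m + 1) iter (numF + i) (numD + k) acc st' := by
  obtain ⟨a, ha, -, hacc, hm, hD, hF⟩ := h
  refine ⟨a, ha, fun h => by rw [h] at hrank; simp [Stage.rank] at hrank, fun _ => hacc hst, by omega, ?_, by omega⟩
  obtain ⟨t, ht⟩ := Nat.exists_eq_add_of_le hrounds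
  rw [ht, Nat.add_sub_cancel_left] at hk
  rw [ht]
  calc numD + k ≤ P.p * (iter * (maxRetries P L ε + 2) + a + st.rounds) + P.p * t :=
        add_le_add hD hk
    _ = _ := by ring

theorem WorkInv.next {m iter numF numD : ℕ} {acc : ℕ → ℝ} {s : Vec n} {δ' f0 fp : ℝ} {b : Bool}
    (h : WorkInv P L ε m iter numF numD acc (Stage.update s δ' f0 fp b)) :
    WorkInv P L ε (m + 1) (iter + 1) numF numD acc (Stage.start : Stage n) := by
  obtain ⟨a, ha, -, hacc, hm, hD, hF⟩ := h
  simp only [Stage.rank, Stage.rounds, Stage.evals] at hm hD hF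
  refine ⟨0, Nat.zero_le _, fun _ => rfl, fun h => absurd rfl h, ?_, ?_, ?_⟩
  -- An iteration takes seven transitions (rank 6 at `update`, plus this one) and two for each
  -- reduction.
  · have : (iter + 1) * (2 * maxRetries P L ε + 7)
        = iter * (2 * maxRetries P L ε + 7) + (2 * maxRetries P L ε + 7) := by ring
    simp only [Stage.rank]
    omega
  · refine hD.trans (Nat.mul_le_mul_left _ ?_)
    simp only [Stage.rounds]
    have : (iter + 1) * (maxRetries P L ε + 2)
        = iter * (maxRetries P L ε + 2) + (maxRetries P L ε + 2) := by ring
    omega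
  · simp only [Stage.evals]
    omega

theorem WorkInv.bounds {m iter numF numD : ℕ} {acc : ℕ → ℝ} {st : Stage n}
    (h : WorkInv P L ε m iter numF numD acc st) (hev : st.evals = 0) :
    numF ≤ 2 * iter ∧ numD ≤ P.p * ((iter + 1) * (maxRetries P L ε + 2)) := by
  obtain ⟨a, ha, -, hacc, hm, hD, hF⟩ := h
  refine ⟨by omega, hD.trans (Nat.mul_le_mul_left _ ?_)⟩
  have h1 : (iter + 1) * (maxRetries P L ε + 2)
        = iter * (maxRetries P L ε + 2) + (maxRetries P L ε + 2) := by ring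
  have h2 : st.rounds ≤ 2 := by cases st <;> simp [Stage.rounds]
  omega

end Invariants

/-! ### Preservation of the invariant and termination. -/

section Transitions

variable {P : Params} {L : ℝ} {n : ℕ} {F : Set (Vec n)} {f : Vec n → ℝ} {x₀ : Vec n} {ε : ℝ}
  {m : ℕ} {c : Config n}

/-- The decrease of the latest success is credited only conditionally until Step 1 fails to stop at
the new point. This lemma discharges the condition; without it only `nS - 1` decreases are counted.
-/
theorem CountInv.of_lt_phi {iter : ℕ} {x : Vec n} {σ δ : ℝ} {e e' : Prop}
    (h : CountInv P L F f x₀ ε iter x σ δ e)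
    (hφ : e → optRatio P * ε * chi P.q δ < phi F (derivs f x) P.q x δ) :
    CountInv P L F f x₀ ε iter x σ δ e' := by
  obtain ⟨nS, nU, h1, h2, h3, h4⟩ := h
  exact ⟨nS, nU, h1, h2, h3, fun _ => h4 hφ⟩

theorem CountInv.reject {iter : ℕ} {x : Vec n} {σ σ' δ δ' : ℝ} {e' : Prop}
    (h : CountInv P L F f x₀ ε iter x σ δ False) (hσ : P.γ₂ * σ ≤ σ') :
    CountInv P L F f x₀ ε (iter + 1) x σ' δ' e' := by
  obtain ⟨nS, nU, h1, h2, h3, h4⟩ := h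
  refine ⟨nS, nU + 1, by omega, ?_, h3, fun _ => h4 False.elim⟩
  have hγ : 0 < P.γ₂ := zero_lt_one.trans P.one_lt_γ₂
  calc P.σ₀ * P.γ₁ ^ nS * P.γ₂ ^ (nU + 1) = P.γ₂ * (P.σ₀ * P.γ₁ ^ nS * P.γ₂ ^ nU) := by ring
    _ ≤ P.γ₂ * σ := by gcongr
    _ ≤ σ' := hσ

/-- Past the early stages all earlier successes are fully credited, so monotonicity of `f` gives the
count with one success outstanding, and `hφ` supplies the conditional credit. -/
theorem CountInv.accept {iter : ℕ} {x x' : Vec n} {σ σ' δ δ' : ℝ} {e' : Prop}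
    (h : CountInv P L F f x₀ ε iter x σ δ False) (hσ : P.γ₁ * σ ≤ σ') (he' : e') (hf : f x' ≤ f x)
    (hφ : optRatio P * ε * chi P.q δ' < phi F (derivs f x') P.q x' δ' →
      f x' + decConst P L * ε ^ P.rate ≤ f x) :
    CountInv P L F f x₀ ε (iter + 1) x' σ' δ' e' := by
  obtain ⟨nS, nU, h1, h2, h3, h4⟩ := h
  have h5 := h4 False.elim
  refine ⟨nS + 1, nU, by omega, ?_, ?_, fun h => ?_⟩
  · have hγ := P.γ₁_mem.1
    calc P.σ₀ * P.γ₁ ^ (nS + 1) * P.γ₂ ^ nU = P.γ₁ * (P.σ₀ * P.γ₁ ^ nS * P.γ₂ ^ nU) := by ring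
      _ ≤ P.γ₁ * σ := by gcongr
      _ ≤ σ' := hσ
  · push_cast
    rw [add_sub_cancel_right]
    linarith
  · have := hφ (h he')
    push_cast
    linarith

theorem increment_nonneg_of_model_le {D : ∀ j, Tensor n j} {σ : ℝ} (hσ : 0 ≤ σ) {s : Vec n}
    (h : P.model D σ s ≤ P.model D σ 0) : 0 ≤ taylorDecrease D P.p s := by
  rw [model_zero] at h
  unfold Params.model at h
  have h1 : 0 ≤ σ / fracFactorial P.p P.β * ‖s‖ ^ ((P.p : ℝ) + P.β) :=
    mul_nonneg (div_nonneg hσ (fracFactorial_pos _ P.β_mem.1).le)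
      (Real.rpow_nonneg (norm_nonneg _) _)
  linarith

theorem exists_acc_of_flagS_eq_zero (hε : 0 < ε) (hσ : 0 < c.σ) (hσm : c.σ ≤ sigmaMax P L)
    {s : Vec n} (hT : 0 ≤ taylorDecrease c.D P.p s) (hf : flagS P ε c s = 0) :
    ∃ j ∈ Finset.Icc 1 P.p, accConst P L * ε < c.acc j := by
  obtain ⟨j, hj, h⟩ := exists_of_verify_eq_zero (norm_nonneg s) hT hf
  exact ⟨j, hj, (accConst_mul_le_xi P hε hσ hσm).trans_lt h⟩

theorem Icc_q_subset : Finset.Icc 1 P.q ⊆ Finset.Icc 1 P.p :=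
  Finset.Icc_subset_Icc le_rfl P.q_le_p

theorem exists_acc_of_check1 (hF : IsClosed F) (hε : 0 < ε) (hσ : 0 < c.σ)
    (hσm : c.σ ≤ sigmaMax P L) (hx : c.x ∈ F) (hδ : 0 < c.δ) {flag : ℕ}
    (h : Check1 P F ε c flag) (hf : flag = 0) :
    ∃ j ∈ Finset.Icc 1 P.p, accConst P L * ε < c.acc j := by
  obtain ⟨v, hv, hflag⟩ := h
  have hv0 : 0 ≤ v := by
    rw [hv.unique (isGreatest_phi hF hx hδ.le)]
    exact phi_nonneg hF hx hδ.le
  obtain ⟨j, hj, h⟩ := exists_of_verify_eq_zero hδ.le hv0 (hflag.symm.trans hf)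
  exact ⟨j, Icc_q_subset hj, (accConst_mul_le_xi P hε hσ hσm).trans_lt h⟩

theorem exists_acc_of_flagD_eq_zero (hF : IsClosed F) (hε : 0 < ε) (hσ : 0 < c.σ)
    (hσm : c.σ ≤ sigmaMax P L) {s : Vec n} {δ' v : ℝ} (h : Candidate P F ε c s δ' v)
    (hf : flagD P ε c δ' v = 0) :
    ∃ j ∈ Finset.Icc 1 P.p, accConst P L * ε < c.acc j := by
  have hδv : 0 < δ' ∧ 0 ≤ v := by
    rcases h.2 with ⟨h1, h2⟩ | ⟨-, h1, -, h2⟩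
    · have hδ := h1.2.2.2.1.1
      rw [h2.unique (isGreatest_phi hF h1.2.1 hδ.le)]
      exact ⟨hδ, phi_nonneg hF h1.2.1 hδ.le⟩
    · exact ⟨h1.1, h2.ge⟩
  obtain ⟨j, hj, h⟩ := exists_of_verify_eq_zero hδv.1.le hδv.2 hf
  have := accConst_mul_le_xiModel P hε hσ hσm
  exact ⟨j, Icc_q_subset hj, by linarith⟩

theorem RunInv.retry2 (hε : 0 < ε) (h : RunInv P L F f x₀ ε m c) (hc : c.stage = Stage.check2)
    (hj : ∃ j ∈ Finset.Icc 1 P.p, accConst P L * ε < c.acc j) :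
    RunInv P L F f x₀ ε (m + 1)
      { c with acc := fun j => P.γε * c.acc j, stage := Stage.eval2 } := by
  have hcount := h.count
  have hwork := h.work
  have hdata := h.data
  rw [hc] at hcount hwork hdata
  obtain ⟨a, ha⟩ := h.acc (by rw [hc]; simp)
  refine ⟨h.mem, h.σmin_le, h.le_sigmaMax, h.radius, h.value, hcount, ?_, ?_⟩
  · exact hwork.reduce hε (by simp) (by simp) rfl rfl rfl hj
  · exact AfterEval.retry hdata fun j hj => (ha.1 j hj).1

theorem GoodStep.of_eq {c c' : Config n} {s : Vec n} {δ' : ℝ} (h : GoodStep P F ε L f c s δ')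
    (hx : c'.x = c.x) (hσ : c'.σ = c.σ) (hD : c'.D = c.D) : GoodStep P F ε L f c' s δ' := by
  obtain ⟨h1, h2, h3, h4, h5, h6⟩ := h
  constructor
  · rwa [hx]
  · exact h2
  · rwa [hσ, hD]
  · exact h4
  · rwa [hσ, hD, hx]
  · rwa [hσ, hx]

/-- Every transition preserves the invariant or finishes the run. -/
theorem RunInv.step (hF : IsClosed F) (hε : ε ∈ Ioo (0 : ℝ) 1) (hL : 0 ≤ L)
    (hf : HolderSmooth P.p P.β L f) {gap fLow : ℝ} (hlow : ∀ x, fLow ≤ f x)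
    (hgap : f x₀ - fLow ≤ gap) {c' : Config n} (h : RunInv P L F f x₀ ε m c)
    (hstep : Step P F ε c c') (hM : LocalMeets P f c c') :
    RunInv P L F f x₀ ε (m + 1) c' ∨ Finished P L F f ε gap c' := by
  have hε0 := hε.1
  have hσ := h.σ_pos
  have hcount := h.count
  have hwork := h.work
  have hdata := h.data
  have hiter := h.iter_le hL hε hlow hgap
  cases hstep with
  | choose e hc he =>
    left
    rw [hc] at hcount hwork hdata
    refine ⟨h.mem, h.σmin_le, h.le_sigmaMax, h.radius, h.value, hcount, ?_, fun j =>
      Or.inl (hdata j)⟩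
    obtain ⟨a, ha, ha0, -, hm, hD, hF'⟩ := hwork
    obtain rfl := ha0 rfl
    refine ⟨0, ha, fun h => by simp at h, fun _ => ⟨fun j hj => ?_, he.2⟩, ?_, hD, hF'⟩
    · rw [pow_zero, mul_one]
      exact he.1 j hj
    · simp only [Stage.rank] at hm ⊢
      omega
  | eval1 _ hc hev =>
    left
    rw [hc] at hcount hwork hdata
    have hA := hev.afterEval hdata
    obtain ⟨S, D', got', hS, -, -, -, rfl⟩ := hev
    refine ⟨h.mem, h.σmin_le, h.le_sigmaMax, h.radius, h.value, hcount, ?_, hA⟩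
    refine hwork.advance (by simp) (by simp [Stage.rank]) (i := 0) ?_ (by simp [Stage.rounds])
      (by simp [Stage.evals])
    have := Finset.card_le_card (hS.trans Icc_q_subset)
    simpa [Stage.rounds] using this
  | stop1 flag hc hch hfl =>
    right
    rw [hc] at hwork hdata
    have hA := AfterEval.accurate hdata (hM.step1 hc (by simp))
    have hb := hwork.bounds rfl
    refine ⟨⟨h.mem, Or.inl ⟨Or.inl rfl, c.δ, h.radius, ?_⟩⟩, hiter, hb.1, hb.2⟩
    exact phi_le_of_stop1 P hF hε0 hσ h.mem h.radius.1 hA.2 hch hfl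
  | pass1 flag hc hch hfl =>
    left
    rw [hc] at hcount hwork hdata
    have hA := AfterEval.accurate hdata (hM.step1 hc (by simp))
    refine ⟨h.mem, h.σmin_le, h.le_sigmaMax, h.radius, h.value, ?_, ?_, fun j =>
      Or.inl (hA.1 j)⟩
    · exact hcount.of_lt_phi fun _ =>
        lt_phi_of_pass1 P hF hε0 hσ h.mem h.radius.1 hA.2 hch hfl
    · exact hwork.advance (st' := Stage.eval2) (k := 0) (i := 0) (by simp)
        (by simp [Stage.rank]) (Nat.zero_le _) (by simp [Stage.rounds]) (by simp [Stage.evals])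
  | retry1 flag hc hch hfl =>
    left
    rw [hc] at hcount hwork hdata
    obtain ⟨a, ha⟩ := h.acc (by rw [hc]; simp)
    refine ⟨h.mem, h.σmin_le, h.le_sigmaMax, h.radius, h.value, hcount, ?_, ?_⟩
    · exact hwork.reduce hε0 (by simp) (by simp) rfl rfl rfl
        (exists_acc_of_check1 hF hε0 hσ h.le_sigmaMax h.mem h.radius.1 hch hfl)
    · exact AfterEval.retry hdata fun j hj => (ha.1 j (Icc_q_subset hj)).1
  | eval2 _ hc hev =>
    left
    rw [hc] at hcount hwork hdata
    have hA := hev.afterEval hdata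
    obtain ⟨S, D', got', hS, -, -, -, rfl⟩ := hev
    refine ⟨h.mem, h.σmin_le, h.le_sigmaMax, h.radius, h.value, hcount, ?_, hA⟩
    refine hwork.advance (by simp) (by simp [Stage.rank]) (i := 0) ?_ (by simp [Stage.rounds])
      (by simp [Stage.evals])
    have := Finset.card_le_card hS
    simpa [Stage.rounds] using this
  | retryTrial s δ' hc hs hfl =>
    left
    exact h.retry2 hε0 hc (exists_acc_of_flagS_eq_zero hε0 hσ h.le_sigmaMax
      (increment_nonneg_of_model_le hσ.le hs.2.2.1.le) hfl)
  | retryGlobal s hc hs hfl =>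
    left
    exact h.retry2 hε0 hc (exists_acc_of_flagS_eq_zero hε0 hσ h.le_sigmaMax
      (increment_nonneg_of_model_le hσ.le (hs.2.2 0 (by rw [add_zero]; exact h.mem))) hfl)
  | retryModel s δ' v hc hs hl hfl =>
    left
    exact h.retry2 hε0 hc (exists_acc_of_flagD_eq_zero hF hε0 hσ h.le_sigmaMax hs hfl)
  | stop2 s hc hs hfl =>
    right
    rw [hc] at hwork hdata
    have hA := AfterEval.accurate hdata (hM.step2 hc (by simp))
    have hb := hwork.bounds rfl
    refine ⟨⟨h.mem, ?_⟩, hiter, hb.1, hb.2⟩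
    rcases solved_of_stop2 P hF hε0 hσ h.mem hA.2 hs hfl with h1 | h1
    · exact Or.inl ⟨Or.inr ⟨s, rfl⟩, h1⟩
    · exact Or.inr ⟨s, rfl, h1⟩
  | pass2 s δ' v hc hs hfl =>
    left
    rw [hc] at hcount hwork hdata
    have hA := AfterEval.accurate hdata (hM.step2 hc (by simp))
    obtain ⟨a, ha⟩ := h.acc (by rw [hc]; simp)
    have hG := goodStep_of_candidate hF hε hL hf hσ h.mem ha.2 hA.2 hs hfl
    refine ⟨h.mem, h.σmin_le, h.le_sigmaMax, h.radius, h.value, hcount, ?_, hA.1,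
      hG.of_eq rfl rfl rfl⟩
    exact hwork.advance (st' := Stage.evalF s δ') (k := 0) (i := 0) (by simp)
      (by simp [Stage.rank]) (Nat.zero_le _) (by simp [Stage.rounds]) (by simp [Stage.evals])
  | computeF s δ' f0 fp hc =>
    left
    rw [hc] at hcount hwork hdata
    refine ⟨h.mem, h.σmin_le, h.le_sigmaMax, h.radius, h.value, hcount, ?_, hdata.1,
      hdata.2.of_eq rfl rfl rfl, fun h => by simp at h⟩
    exact hwork.advance (st' := Stage.update s δ' f0 fp true) (k := 0) (i := 2) (by simp)
      (by simp [Stage.rank]) (Nat.zero_le _) (by simp [Stage.rounds]) (by simp [Stage.evals])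
  | reuseF s δ' fp hc hg =>
    left
    rw [hc] at hcount hwork hdata
    refine ⟨h.mem, h.σmin_le, h.le_sigmaMax, h.radius, h.value, hcount, ?_, hdata.1,
      hdata.2.of_eq rfl rfl rfl, fun _ => ?_⟩
    · exact hwork.advance (st' := Stage.update s δ' c.fval fp false) (k := 0) (i := 1) (by simp)
        (by simp [Stage.rank]) (Nat.zero_le _) (by simp [Stage.rounds]) (by simp [Stage.evals])
    -- A reused value keeps the error bound of its original request, which is at least as fine.
    · obtain ⟨g, hg1, hg2⟩ := WithTop.le_coe_iff.1 hg
      exact (h.value g hg1).trans hg2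
  | accept s δ' f0 fp b σ' hc hρ hσ' =>
    left
    rw [hc] at hcount hwork hdata
    have hp := hM.trial s δ' f0 fp b hc
    have h0 : |f0 - f c.x| ≤ fAcc P c s := by
      cases b with
      | false => exact hdata.2.2 rfl
      | true => exact hM.iterate s δ' f0 fp hc
    have hG := hdata.2.1
    have hdec := hG.sufficient_decrease hσ h.σmin_le h0 hp hρ
    obtain ⟨b1, b2, b3, -⟩ := hσ'.bounds P hσ h.σmin_le h.le_sigmaMax
      fun hs => hG.very_successful hσ hL hf hs h0 hp
    refine ⟨hG.mem, b1, b2, hG.radius, ?_, ?_, hwork.next, ?_⟩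
    · intro g hg
      rw [← WithTop.coe_inj.1 hg]
      exact hp
    · refine hcount.accept (b3 hρ) trivial ?_ fun hφ => ?_
      · have h1 := decFactor_pos P
        have h2 : 0 ≤ ‖s‖ ^ ((P.p : ℝ) + P.β) := Real.rpow_nonneg (norm_nonneg _) _
        have h3 := mul_nonneg h1.le h2
        unfold decFactor at h3
        show f (c.x + s) ≤ f c.x
        linarith
      · have h1 := decConst_le_of_goodStep P hε hL hσ h.le_sigmaMax hG hφ
        unfold decFactor at h1
        show f (c.x + s) + _ ≤ f c.x
        linarith
    -- The point has changed, so `got` is reset to `⊤` and no tensor claims an accuracy.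
    · intro j g hg
      exact absurd hg (by simp)
  | reject s δ' f0 fp b σ' hc hρ hσ' =>
    left
    rw [hc] at hcount hwork hdata
    have hp := hM.trial s δ' f0 fp b hc
    have h0 : |f0 - f c.x| ≤ fAcc P c s := by
      cases b with
      | false => exact hdata.2.2 rfl
      | true => exact hM.iterate s δ' f0 fp hc
    have hG := hdata.2.1
    obtain ⟨b1, b2, -, b4⟩ := hσ'.bounds P hσ h.σmin_le h.le_sigmaMax
      fun hs => hG.very_successful hσ hL hf hs h0 hp
    refine ⟨h.mem, b1, b2, hG.radius, ?_, hcount.reject (b4 hρ), hwork.next, hdata.1⟩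
    intro g hg
    rw [← WithTop.coe_inj.1 hg]
    exact h0
  | halted hc =>
    exfalso
    rcases hc with hc | ⟨s, hc⟩
    · rw [hc] at hdata
      exact hdata
    · rw [hc] at hdata
      exact hdata

theorem runInv_initial (hx₀ : x₀ ∈ F) (hL : 0 ≤ L) (hε : 0 < ε) :
    RunInv P L F f x₀ ε 0 (Config.initial P x₀) where
  mem := hx₀
  σmin_le := P.σmin_mem.2
  le_sigmaMax := σ₀_le_sigmaMax P
  radius := P.δinit_mem
  value g hg := absurd hg (by simp [Config.initial])
  count := by
    have h1 : 0 ≤ decConst P L * ε ^ P.rate :=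
      mul_nonneg (decConst_pos P hL).le (Real.rpow_nonneg hε.le _)
    refine ⟨0, 0, rfl, ?_, ?_, fun _ => ?_⟩
    · simp [Config.initial]
    · simp only [Config.initial, Nat.cast_zero]
      linarith
    · simp [Config.initial]
  work := ⟨0, Nat.zero_le _, fun _ => rfl, fun h => absurd rfl h, by simp [Config.initial],
    by simp [Config.initial], by simp [Config.initial]⟩
  data j g hg := absurd hg (by simp [Config.initial])

/-- A run whose accuracy requirements are met in the first iterations terminates with a solution
within the complexity bounds. -/
theorem exists_finished (hF : IsClosed F) (hx₀ : x₀ ∈ F) (hε : ε ∈ Ioo (0 : ℝ) 1) (hL : 0 ≤ L)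
    (hf : HolderSmooth P.p P.β L f) {gap fLow : ℝ} (hlow : ∀ x, fLow ≤ f x)
    (hgap : f x₀ - fLow ≤ gap) {ρ : ℕ → Config n} (hρ : IsRun P F ε x₀ ρ)
    (hM : ∀ k : ℕ, (k : ℝ) ≤ iterConst P L gap * ε ^ (-P.rate) → ∀ i, Meets P f ρ k i) :
    ∃ m, Finished P L F f ε gap (ρ m) := by
  by_contra hcon
  push Not at hcon
  have hinv : ∀ m, RunInv P L F f x₀ ε m (ρ m) := by
    intro m
    induction m with
    | zero =>
      rw [hρ.1]
      exact runInv_initial hx₀ hL hε.1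
    | succ m ih =>
      -- No circularity: the invariant before the transition bounds the iteration index, so the
      -- requirements of this iteration are available.
      have hLM := localMeets_of_meets (hM _ (ih.iter_le hL hε hlow hgap))
      exact (ih.step hF hε hL hf hlow hgap (hρ.2 m) hLM).resolve_right (hcon _)
  set K := ⌊iterConst P L gap * ε ^ (-P.rate)⌋₊
  obtain ⟨N, hN⟩ : ∃ N, N = maxRetries P L ε := ⟨_, rfl⟩
  -- One transition more than the work invariant permits with `iter ≤ K`, `a ≤ N` and rank at most
  -- 6.
  have h := hinv (K * (2 * N + 7) + 2 * N + 7)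
  have hk : (ρ (K * (2 * N + 7) + 2 * N + 7)).iter ≤ K :=
    Nat.le_floor (h.iter_le hL hε hlow hgap)
  obtain ⟨a, ha, -, -, hm, -⟩ := h.work
  rw [← hN] at ha hm
  have h1 := Nat.mul_le_mul_right (2 * N + 7) hk
  have h2 : (ρ (K * (2 * N + 7) + 2 * N + 7)).stage.rank ≤ 6 := by
    cases (ρ (K * (2 * N + 7) + 2 * N + 7)).stage <;> simp [Stage.rank]
  omega

end Transitions

/-! ### The union bound and the final constants. -/

theorem one_sub_le_measureReal_biInter {Ω ι : Type*} [MeasurableSpace Ω] (Pr : Measure Ω)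
    [IsProbabilityMeasure Pr] (s : Finset ι) {E : ι → Set Ω} {t : ℝ}
    (hE : ∀ i, MeasurableSet (E i)) (ht : ∀ i, 1 - t ≤ Pr.real (E i)) :
    1 - (s.card : ℝ) * t ≤ Pr.real (⋂ i ∈ s, E i) := by
  have hm : MeasurableSet (⋂ i ∈ s, E i) := s.measurableSet_biInter fun i _ => hE i
  have h1 := probReal_compl_eq_one_sub (μ := Pr) hm
  have h2 : Pr.real (⋂ i ∈ s, E i)ᶜ ≤ ∑ i ∈ s, Pr.real (E i)ᶜ := by
    rw [compl_iInter₂]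
    exact measureReal_biUnion_finset_le s _
  have h3 : ∑ i ∈ s, Pr.real (E i)ᶜ ≤ ∑ _i ∈ s, t := by
    refine Finset.sum_le_sum fun i _ => ?_
    rw [probReal_compl_eq_one_sub (hE i)]
    linarith [ht i]
  rw [Finset.sum_const, nsmul_eq_mul] at h3
  linarith

/-- The constant of the complexity bounds. -/
noncomputable def complexityConst (P : Params) (L gap : ℝ) : ℝ :=
  (iterConst P L gap + 1) * (P.p * (retryConst P L + 2) + 2)

theorem Finished.bounds {P : Params} {L gap ε : ℝ} (hL : 0 ≤ L) {n : ℕ} {F : Set (Vec n)}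
    {f : Vec n → ℝ} {c : Config n} (hε : ε ∈ Ioo (0 : ℝ) 1) (h : Finished P L F f ε gap c) :
    Solved P F f ε c ∧ (c.iter : ℝ) + 1 ≤ complexityConst P L gap * ε ^ (-P.rate) ∧
      (c.numF : ℝ) ≤ complexityConst P L gap * ε ^ (-P.rate) ∧
      (c.numD : ℝ) ≤ complexityConst P L gap * ((1 + |Real.log ε|) * ε ^ (-P.rate)) := by
  obtain ⟨hS, hi, hF, hD⟩ := h
  have hR := one_le_rpow_neg_rate P hε
  have hI := iterConst_nonneg P hL gap
  have hr := retryConst_pos P (L := L)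
  have hN := maxRetries_le P (L := L) hε
  have hl : 0 ≤ |Real.log ε| := abs_nonneg _
  have hp : (0 : ℝ) ≤ P.p := by positivity
  set R := ε ^ (-P.rate)
  have hi1 : (c.iter : ℝ) + 1 ≤ (iterConst P L gap + 1) * R := by linarith
  have hIR : 0 ≤ (iterConst P L gap + 1) * R := by positivity
  have hF' : (c.numF : ℝ) ≤ 2 * c.iter := by exact_mod_cast hF
  have hD' : (c.numD : ℝ) ≤ P.p * ((c.iter + 1) * (maxRetries P L ε + 2)) := by exact_mod_cast hD
  have hpr : 0 ≤ (P.p : ℝ) * (retryConst P L + 2) := by positivity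
  have h2 : 2 * ((iterConst P L gap + 1) * R) ≤ complexityConst P L gap * R := by
    have := mul_nonneg hIR hpr
    unfold complexityConst
    linarith
  refine ⟨hS, by linarith, by linarith, hD'.trans ?_⟩
  have h3 : (maxRetries P L ε : ℝ) + 2 ≤ (retryConst P L + 2) * (1 + |Real.log ε|) := by
    linarith
  calc (P.p : ℝ) * ((c.iter + 1) * (maxRetries P L ε + 2))
      ≤ P.p * (((iterConst P L gap + 1) * R) * ((retryConst P L + 2) * (1 + |Real.log ε|))) := by
        gcongr
    _ = (iterConst P L gap + 1) * (P.p * (retryConst P L + 2)) * ((1 + |Real.log ε|) * R) := by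
        ring
    _ ≤ _ := by
        unfold complexityConst
        gcongr
        linarith

end ARpDA

theorem mainTheorem4 (P : ARpDA.Params) (L : ℝ) (hL : 0 ≤ L) (gap : ℝ) :
    ∃ C > (0 : ℝ), ∃ c > (0 : ℝ),
      ∀ (n : ℕ) (F : Set (ARpDA.Vec n)) (f : ARpDA.Vec n → ℝ) (fLow : ℝ) (x₀ : ARpDA.Vec n)
        (ε tbar t : ℝ) (Ω : Type*) [MeasurableSpace Ω] (Pr : MeasureTheory.Measure Ω)
        [MeasureTheory.IsProbabilityMeasure Pr] (run : Ω → ℕ → ARpDA.Config n)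
        (E : ℕ × ARpDA.Requirement P → Set Ω),
        IsClosed F → x₀ ∈ F →
        ARpDA.HolderSmooth P.p P.β L f → (∀ x, fLow ≤ f x) → f x₀ - fLow ≤ gap →
        ε ∈ Set.Ioo (0 : ℝ) 1 → tbar ∈ Set.Ioo (0 : ℝ) 1 → t ∈ Set.Ico (0 : ℝ) 1 →
        t ≤ c * (tbar * ε ^ P.rate / ((P.p : ℝ) + P.q + 2)) →
        (∀ w, ARpDA.IsRun P F ε x₀ (run w)) →
        (∀ i, MeasurableSet (E i)) → ProbabilityTheory.iIndepSet E Pr →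
        (∀ i, 1 - t ≤ Pr.real (E i)) →
        (∀ k i, ∀ w ∈ E (k, i), ARpDA.Meets P f (run w) k i) →
        ∃ G : Set Ω, MeasurableSet G ∧ 1 - tbar ≤ Pr.real G ∧
          ∀ w ∈ G, ∃ m : ℕ, ARpDA.Solved P F f ε (run w m) ∧
            ((run w m).iter : ℝ) + 1 ≤ C * ε ^ (-P.rate) ∧
            ((run w m).numF : ℝ) ≤ C * ε ^ (-P.rate) ∧
            ((run w m).numD : ℝ) ≤ C * ((1 + |Real.log ε|) * ε ^ (-P.rate)) := by
  have hI := ARpDA.iterConst_nonneg P hL gap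
  have hr := ARpDA.retryConst_pos P (L := L)
  -- The second constant cancels the number of iterations covered, `⌊B⌋ + 1 ≤ (iterConst + 1) ε ^
  -- (-rate)`, in the union bound.
  refine ⟨ARpDA.complexityConst P L gap, by unfold ARpDA.complexityConst; positivity,
    (ARpDA.iterConst P L gap + 1)⁻¹, by positivity, ?_⟩
  intro n F f fLow x₀ ε tbar t Ω _ Pr _ run E hF hx₀ hf hlow hgap hε htbar ht htc hrun hE _ hPr hM
  classical
  set B := ARpDA.iterConst P L gap * ε ^ (-P.rate) with hB
  set s : Finset (ℕ × ARpDA.Requirement P) := Finset.range (⌊B⌋₊ + 1) ×ˢ Finset.univ with hs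
  -- The good event involves a deterministic range of iterations, although the stopping index is
  -- random.
  refine ⟨⋂ i ∈ s, E i, s.measurableSet_biInter fun i _ => hE i, ?_, fun w hw => ?_⟩
  · refine le_trans ?_ (ARpDA.one_sub_le_measureReal_biInter Pr s hE hPr)
    have hR := ARpDA.one_le_rpow_neg_rate P hε
    have hε0 := hε.1
    have hcan : ε ^ P.rate * ε ^ (-P.rate) = 1 := by
      rw [← Real.rpow_add hε0, add_neg_cancel, Real.rpow_zero]
    have hB0 : 0 ≤ B := by positivity
    have hcard : (s.card : ℝ) = (⌊B⌋₊ + 1) * ((P.p : ℝ) + P.q + 2) := by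
      rw [hs, Finset.card_product, Finset.card_range, Finset.card_univ, Fintype.card_sum,
        Fintype.card_sum, Fintype.card_fin, Fintype.card_fin, Fintype.card_fin]
      push_cast
      ring
    have hfl : (⌊B⌋₊ : ℝ) + 1 ≤ (ARpDA.iterConst P L gap + 1) * ε ^ (-P.rate) := by
      have := Nat.floor_le hB0
      linarith
    have htb := htbar.1
    have hpq : 0 < (P.p : ℝ) + P.q + 2 := by positivity
    have : (s.card : ℝ) * t ≤ tbar := by
      rw [hcard]
      calc ((⌊B⌋₊ : ℝ) + 1) * ((P.p : ℝ) + P.q + 2) * t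
          ≤ ((ARpDA.iterConst P L gap + 1) * ε ^ (-P.rate)) * ((P.p : ℝ) + P.q + 2)
            * ((ARpDA.iterConst P L gap + 1)⁻¹
              * (tbar * ε ^ P.rate / ((P.p : ℝ) + P.q + 2))) := by
            have := ht.1
            gcongr
        _ = tbar * (ε ^ P.rate * ε ^ (-P.rate)) := by
            field_simp
        _ = tbar := by rw [hcan, mul_one]
    linarith
  · have hmeets : ∀ k : ℕ, (k : ℝ) ≤ B → ∀ i, ARpDA.Meets P f (run w) k i := by
      intro k hk i
      refine hM k i w (Set.mem_iInter₂.1 hw (k, i) ?_)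
      rw [hs, Finset.mem_product]
      exact ⟨Finset.mem_range.2 (Nat.lt_succ_of_le (Nat.le_floor hk)), Finset.mem_univ _⟩
    obtain ⟨m, hm⟩ := ARpDA.exists_finished hF hx₀ hε hL hf hlow hgap (hrun w) hmeets
    exact ⟨m, hm.bounds hL hε⟩
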